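/- Let $k$ be a field of characteristic $2$ and let $\mathsf{C}=\mathrm{Ver}_4^+$ be the symmetric monoidal category of finite-dimensional $k[D]/D^2$-modules ($D$ primitive) with braiding $v\otimes w\mapsto w\otimes v+Dw\otimes Dv$. Let $\mathsf{Alg}\,\mathsf{C}$ be the category of commutative algebras in $\mathrm{Ind}\,\mathsf{C}$, let $\mathsf{Fais}\,\mathsf{C}$ be the category of functors $\mathsf{Alg}\,\mathsf{C}\to\mathsf{Set}$ that are sheaves for the fpqc topology (finite families $A\to B_i$ with $A\to\prod_i B_i$ faithfully flat), and write $\Phi_A=\mathrm{Hom}_{\mathsf{Alg}\,\mathsf{C}}(A,-)$. For $X\in\mathsf{C}$ let $\mathbb{P}_X(A)$ be the set of epimorphisms of $A$-modules $A\otimes X^\ast\twoheadrightarrow\mathcal{L}$ with $\mathcal{L}$ an invertible $A$-module, up to isomorphisms of $\mathcal{L}$ that make the triangle commute. Let $P=k[D]/D^2$, with basis $v_1,v_2$ such that $Dv_1=v_2$ and $Dv_2=0$. Let $T\in\mathsf{Alg}\,\mathsf{C}$ be $k[t]/t^4$ with $D(t)=t^2$, and let $\mathcal{L}_u$ be the invertible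 $T$-module whose underlying $k[t]/t^4$-module is the regular one, with $D(1)=t$ (so $D(t^2)=t^3$). Fix an isomorphism $P\simeq P^\ast$. The epimorphism $T\otimes P^\ast\simeq T\otimes P\twoheadrightarrow\mathcal{L}_u$, $1\otimes v_1\mapsto 1$, is an element of $\mathbb{P}_P(T)$, and so defines, by the Yoneda lemma, a natural transformation $\Phi_T\to\mathbb{P}_P$. Then $\Phi_T$ and $\mathbb{P}_P$ belong to $\mathsf{Fais}\,\mathsf{C}$, and this natural transformation is an isomorphism $\Phi_T\simeq\mathbb{P}_P$ in $\mathsf{Fais}\,\mathsf{C}$. In other words, $\mathbb{P}_P$ is the affine $\mathsf{C}$-scheme $\mathrm{Spec}\,T$ (the object $T$ of $(\mathsf{Alg}\,\mathsf{C})^{\mathrm{op}}$, identified with its functor of points $\Phi_T$): it is represented by $T$, with the above element as universal element. -/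

import Mathlib

open CategoryTheory TensorProduct

universe u

noncomputable section

/-!
Algebraic geometry in the tensor category `Ver₄⁺` over a field `k` of characteristic `2`: the
category of `k[D]/D²`-modules (`D` primitive) with the braiding
`v ⊗ w ↦ w ⊗ v + D w ⊗ D v`.
-/

namespace Ver4

/-- An object of the ind-completion of `Ver₄⁺`: a `k[D]/D²`-module, that is, a vector space `V`
with an endomorphism `D` of square zero. The objects of `Ver₄⁺` are those of finite dimension. -/
class IndObj (k V : Type*) [Field k] [AddCommGroup V] [Module k V] where
  D : V →ₗ[k] V
  D_D : ∀ v, D (D v) = 0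

/-- The action of `D`. -/
def D (k : Type*) {V : Type*} [Field k] [AddCommGroup V] [Module k V] [IndObj k V] :
    V →ₗ[k] V := IndObj.D

@[simp]
theorem D_D (k : Type*) {V : Type*} [Field k] [AddCommGroup V] [Module k V] [IndObj k V] (v : V) :
    D k (D k v) = 0 := IndObj.D_D v

theorem add_self (k : Type*) {V : Type*} [Field k] [CharP k 2] [AddCommGroup V] [Module k V]
    (v : V) : v + v = 0 := by
  have : (2 : k) • v = 0 := by rw [CharTwo.two_eq_zero, zero_smul]
  rwa [two_smul] at this

section tensor
variable (k V W : Type*) [Field k] [AddCommGroup V] [Module k V] [IndObj k V]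
  [AddCommGroup W] [Module k W] [IndObj k W]

/-- The tensor product: `D (v ⊗ w) = D v ⊗ w + v ⊗ D w`, as `D` is primitive. -/
instance tensorObj [CharP k 2] : IndObj k (V ⊗[k] W) where
  D := TensorProduct.map (D k) LinearMap.id + TensorProduct.map LinearMap.id (D k)
  D_D v := by
    induction v with
    | zero => simp
    | add x y hx hy => rw [map_add, map_add, hx, hy, add_zero]
    | tmul x y => simp [add_self k]

/-- The dual: `D` acts by `f ↦ f ∘ D` (the antipode is `D ↦ -D = D`). -/
instance dualObj : IndObj k (Module.Dual k V) where
  D := Module.Dual.transpose (R := k) (D k)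
  D_D f := by ext v; simp [Module.Dual.transpose_apply]

/-- An isomorphism of `k[D]/D²`-modules. -/
structure ObjIso extends V ≃ₗ[k] W where
  map_D : ∀ v, toFun (Ver4.D k v) = Ver4.D k (toFun v)

theorem ObjIso.symm_D (θ : ObjIso k V W) (w : W) :
    θ.toLinearEquiv.symm (D k w) = D k (θ.toLinearEquiv.symm w) := by
  obtain ⟨v, rfl⟩ := θ.toLinearEquiv.surjective w
  have h : D k (θ.toLinearEquiv v) = θ.toLinearEquiv (D k v) := (θ.map_D v).symm
  rw [h, LinearEquiv.symm_apply_apply, LinearEquiv.symm_apply_apply]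

/-- The symmetric braiding `v ⊗ w ↦ w ⊗ v + D w ⊗ D v`. -/
def braid : V ⊗[k] W →ₗ[k] W ⊗[k] V :=
  (TensorProduct.comm k V W).toLinearMap ∘ₗ
    (LinearMap.id + TensorProduct.map (D k) (D k))

@[simp]
theorem D_tmul [CharP k 2] (v : V) (w : W) :
    D k (v ⊗ₜ[k] w) = D k v ⊗ₜ[k] w + v ⊗ₜ[k] D k w := rfl

@[simp]
theorem braid_tmul (v : V) (w : W) :
    braid k V W (v ⊗ₜ[k] w) = w ⊗ₜ[k] v + D k w ⊗ₜ[k] D k v := rfl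

end tensor

/-- A commutative algebra in the ind-completion of `Ver₄⁺`: an associative unital `k`-algebra with
a `D` for which the multiplication `A ⊗ A → A` is a morphism and is invariant under the braiding.
In elements: `D (a b) = D a * b + a * D b` and `a b = b a + D b * D a`. The underlying ring is
in general not commutative. -/
class ComAlg (k A : Type*) [Field k] [CharP k 2] [Ring A] [Algebra k A] extends IndObj k A where
  D_mul' : Ver4.D k ∘ₗ LinearMap.mul' k A = LinearMap.mul' k A ∘ₗ Ver4.D k
  mul_braid : LinearMap.mul' k A ∘ₗ braid k A A = LinearMap.mul' k A

section alg
variable (k : Type*) {A : Type*} [Field k] [CharP k 2] [Ring A] [Algebra k A] [ComAlg k A]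

theorem D_mul (a b : A) : D k (a * b) = D k a * b + a * D k b := by
  simpa using LinearMap.congr_fun (ComAlg.D_mul' (k := k) (A := A)) (a ⊗ₜ b)

theorem mul_comm' (a b : A) : b * a + D k b * D k a = a * b := by
  simpa using LinearMap.congr_fun (ComAlg.mul_braid (k := k) (A := A)) (a ⊗ₜ b)

@[simp]
theorem D_one : D k (1 : A) = 0 := by
  have := D_mul k (1 : A) 1
  simpa using this

end alg

/-- An `A`-module in the ind-completion of `Ver₄⁺`: the action `A ⊗ M → M` is a morphism. -/
class IsMod (k A M : Type*) [Field k] [CharP k 2] [Ring A] [Algebra k A] [ComAlg k A]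
    [AddCommGroup M] [Module k M] [Module A M] [IndObj k M] : Prop where
  D_smul : ∀ (a : A) (m : M), D k (a • m) = D k a • m + a • D k m

instance (k A : Type*) [Field k] [CharP k 2] [Ring A] [Algebra k A] [ComAlg k A] :
    IsMod k A A where
  D_smul := D_mul k

instance tensorIsMod (k A M V : Type*) [Field k] [CharP k 2] [Ring A] [Algebra k A] [ComAlg k A]
    [AddCommGroup M] [Module k M] [Module A M] [IsScalarTower k A M] [IndObj k M] [IsMod k A M]
    [AddCommGroup V] [Module k V] [IndObj k V] : IsMod k A (M ⊗[k] V) where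
  D_smul a x := by
    induction x with
    | zero => simp
    | add x y hx hy => simp only [smul_add, map_add, hx, hy]; abel
    | tmul x y =>
      simp only [TensorProduct.smul_tmul', D_tmul, IsMod.D_smul, TensorProduct.add_tmul, smul_add]
      abel

section quot
variable {k A M : Type*} [Field k] [CharP k 2] [Ring A] [Algebra k A] [ComAlg k A]
    [AddCommGroup M] [Module k M] [Module A M] [IndObj k M] [IsMod k A M]

theorem span_stable (s : Set M) (h : ∀ x ∈ s, D k x ∈ Submodule.span A s)
    (x : M) (hx : x ∈ Submodule.span A s) : D k x ∈ Submodule.span A s := by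
  induction hx using Submodule.span_induction with
  | mem x hx => exact h x hx
  | zero => simp
  | add x y _ _ hx hy => rw [map_add]; exact add_mem hx hy
  | smul a x hx hx' =>
    rw [IsMod.D_smul (k := k)]
    exact add_mem (Submodule.smul_mem _ _ hx) (Submodule.smul_mem _ _ hx')

@[reducible]
def quotObj [IsScalarTower k A M] (S : Submodule A M) (h : ∀ x ∈ S, D k x ∈ S) : IndObj k (M ⧸ S) where
  D := (Submodule.Quotient.restrictScalarsEquiv k S).toLinearMap ∘ₗ
    (S.restrictScalars k).mapQ (S.restrictScalars k) (D k) h ∘ₗ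
    (Submodule.Quotient.restrictScalarsEquiv k S).symm.toLinearMap
  D_D x := by
    obtain ⟨x, rfl⟩ := Submodule.Quotient.mk_surjective _ x
    exact congrArg (Submodule.Quotient.mk (p := S)) (D_D k x)
end quot

/-- The objects of the category of commutative algebras in the ind-completion of `Ver₄⁺`. -/
structure AlgC (k : Type u) [Field k] [CharP k 2] where
  carrier : Type u
  [ring : Ring carrier]
  [algebra : Algebra k carrier]
  [comAlg : ComAlg k carrier]

namespace AlgC
variable {k : Type u} [Field k] [CharP k 2]

instance : CoeSort (AlgC k) (Type u) := ⟨carrier⟩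
attribute [instance] ring algebra comAlg

/-- Algebra morphisms commuting with `D`. -/
@[ext]
structure Hom (A B : AlgC k) extends A →ₐ[k] B where
  map_D : ∀ a : A, toFun (D k a) = D k (toFun a)

instance : Category (AlgC k) where
  Hom A B := Hom A B
  id A := ⟨AlgHom.id k A, fun _ => rfl⟩
  comp f g := ⟨g.toAlgHom.comp f.toAlgHom, fun a => (congrArg g.toFun (f.map_D a)).trans (g.map_D _)⟩

instance (A B : AlgC k) : FunLike (A ⟶ B) A B where
  coe f := f.toFun
  coe_injective f g h := by
    exact Hom.ext h

instance (A B : AlgC k) : AlgHomClass (A ⟶ B) k A B where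
  map_mul f := f.map_mul'
  map_one f := f.map_one'
  map_add f := f.map_add'
  map_zero f := f.map_zero'
  commutes f := f.commutes'

@[simp] theorem id_apply (A : AlgC k) (a : A) : (𝟙 A : A ⟶ A) a = a := rfl
@[simp] theorem comp_apply {A B C : AlgC k} (f : A ⟶ B) (g : B ⟶ C) (a : A) :
    (f ≫ g) a = g (f a) := rfl
@[simp] theorem map_D {A B : AlgC k} (f : A ⟶ B) (a : A) : f (D k a) = D k (f a) := Hom.map_D f a

instance piComAlg {ι : Type} (B : ι → AlgC k) : ComAlg k (∀ i, B i) where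
  D := LinearMap.pi fun i => D k ∘ₗ LinearMap.proj i
  D_D v := by ext i; simp
  D_mul' := by
    ext a b i
    exact D_mul k (a i) (b i)
  mul_braid := by
    ext a b i
    exact mul_comm' k (a i) (b i)

/-- The product of a family of algebras. -/
def prod {ι : Type} (B : ι → AlgC k) : AlgC k := ⟨∀ i, B i⟩

/-- The morphism to the product given by a family of morphisms. -/
def prodLift {ι : Type} {A : AlgC k} (B : ι → AlgC k) (φ : ∀ i, A ⟶ B i) : A ⟶ prod B where
  toAlgHom := AlgHom.pi fun i => (φ i).toAlgHom
  map_D a := funext fun i => map_D (φ i) a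

end AlgC

/-- The `A`-modules in the ind-completion of `Ver₄⁺`. -/
structure ModC {k : Type u} [Field k] [CharP k 2] (A : AlgC k) where
  carrier : Type u
  [addCommGroup : AddCommGroup carrier]
  [moduleBase : Module k carrier]
  [module : Module A carrier]
  [tower : IsScalarTower k A carrier]
  [obj : IndObj k carrier]
  [isMod : IsMod k A carrier]

namespace ModC
variable {k : Type u} [Field k] [CharP k 2] {A B C : AlgC k}

instance : CoeSort (ModC A) (Type u) := ⟨carrier⟩
attribute [instance] addCommGroup moduleBase module tower obj isMod

/-- Morphisms of `A`-modules: `A`-linear maps commuting with `D`. -/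
structure Hom (M N : ModC A) extends M →ₗ[A] N where
  map_D : ∀ m : M, toFun (D k m) = D k (toFun m)

/-- Isomorphisms of `A`-modules. -/
structure Iso (M N : ModC A) extends M ≃ₗ[A] N where
  map_D : ∀ m : M, toFun (D k m) = D k (toFun m)

/-- The regular module. -/
abbrev self (A : AlgC k) : ModC A := ⟨A⟩

/-- The free module `A ⊗ V`. -/
abbrev free (A : AlgC k) (V : Type u) [AddCommGroup V] [Module k V] [IndObj k V] : ModC A :=
  ⟨A ⊗[k] V⟩

/-- The relations `m · a ⊗ n = m ⊗ a n` defining `M ⊗_A N` as a quotient of `M ⊗ N`, where the right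
action of `A` on `M` is the left action composed with the braiding `M ⊗ A → A ⊗ M`, so that
`m · a = a m + D a (D m)`. -/
def tensorRel (M N : ModC A) : Submodule A (M ⊗[k] N) :=
  Submodule.span A {x | ∃ (m : M) (a : A) (n : N),
    x = (a • m + D k a • D k m) ⊗ₜ[k] n - m ⊗ₜ[k] (a • n)}

theorem tensorRel_stable (M N : ModC A) : ∀ x ∈ tensorRel M N, D k x ∈ tensorRel M N := by
  refine span_stable _ ?_
  rintro _ ⟨m, a, n, rfl⟩
  have key : ∀ (m : M) (a : A) (n : N),
      (a • m + D k a • D k m) ⊗ₜ[k] n - m ⊗ₜ[k] (a • n) ∈ tensorRel M N :=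
    fun m a n => Submodule.subset_span ⟨m, a, n, rfl⟩
  have h := add_mem (add_mem (key (D k m) a n) (key m (D k a) n)) (key m a (D k n))
  refine (congrArg (· ∈ _) ?_).mpr h
  simp only [map_sub, D_tmul, map_add, IsMod.D_smul (k := k), D_D, TensorProduct.add_tmul,
    TensorProduct.tmul_add, smul_zero, zero_smul, TensorProduct.zero_tmul]
  abel

instance (M N : ModC A) : IndObj k ((M ⊗[k] N) ⧸ tensorRel M N) :=
  quotObj _ (tensorRel_stable M N)

/-- The tensor product `M ⊗_A N` of `A`-modules. -/
def tensor (M N : ModC A) : ModC A where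
  carrier := (M ⊗[k] N) ⧸ tensorRel M N
  isMod := ⟨fun a x => by
    obtain ⟨x, rfl⟩ := Submodule.Quotient.mk_surjective _ x
    exact congrArg (Submodule.Quotient.mk (p := tensorRel M N)) (IsMod.D_smul (k := k) a x)⟩

/-- A module is invertible if it has an inverse for `⊗_A`. -/
def Invertible (M : ModC A) : Prop := ∃ N : ModC A, Nonempty (Iso (tensor M N) (self A))

/-- The relations `b φ(a) ⊗ l = b ⊗ a l` defining `B ⊗_A L` as a quotient of `B ⊗ L`; by
commutativity of `B`, the right action `b ↦ b φ(a)` is the left action of `A` composed with the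
braiding. -/
def bcRel (φ : A ⟶ B) (L : ModC A) : Submodule B (B ⊗[k] L) :=
  Submodule.span B {x | ∃ (b : B) (a : A) (l : L),
    x = (b * φ a) ⊗ₜ[k] l - b ⊗ₜ[k] (a • l)}

theorem bcRel_stable (φ : A ⟶ B) (L : ModC A) : ∀ x ∈ bcRel φ L, D k x ∈ bcRel φ L := by
  refine span_stable _ ?_
  rintro _ ⟨m, a, n, rfl⟩
  have key : ∀ (b : B) (a : A) (l : L), (b * φ a) ⊗ₜ[k] l - b ⊗ₜ[k] (a • l) ∈ bcRel φ L :=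
    fun m a n => Submodule.subset_span ⟨m, a, n, rfl⟩
  have h := add_mem (add_mem (key (D k m) a n) (key m (D k a) n)) (key m a (D k n))
  refine (congrArg (· ∈ _) ?_).mpr h
  simp only [map_sub, D_tmul, D_mul, IsMod.D_smul (k := k), TensorProduct.add_tmul,
    TensorProduct.tmul_add, AlgC.map_D]
  abel

instance (φ : A ⟶ B) (L : ModC A) : IndObj k ((B ⊗[k] L) ⧸ bcRel φ L) :=
  quotObj _ (bcRel_stable φ L)

/-- The base change `B ⊗_A L`. -/
def baseChange (φ : A ⟶ B) (L : ModC A) : ModC B where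
  carrier := (B ⊗[k] L) ⧸ bcRel φ L
  isMod := ⟨fun a x => by
    obtain ⟨x, rfl⟩ := Submodule.Quotient.mk_surjective _ x
    exact congrArg (Submodule.Quotient.mk (p := bcRel φ L)) (IsMod.D_smul (k := k) a x)⟩

/-- The class of `b ⊗ l`. -/
def bcMk (φ : A ⟶ B) (L : ModC A) (b : B) (l : L) : baseChange φ L :=
  Submodule.Quotient.mk (b ⊗ₜ[k] l)


theorem mk_smul_bc (φ : A ⟶ B) (L : ModC A) (c b : B) (l : L) :
    c • bcMk φ L b l = bcMk φ L (c * b) l := rfl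

theorem D_bcMk (φ : A ⟶ B) (L : ModC A) (b : B) (l : L) :
    D k (bcMk φ L b l) = bcMk φ L (D k b) l + bcMk φ L b (D k l) := rfl

theorem bcMk_smul (φ : A ⟶ B) (L : ModC A) (b : B) (a : A) (l : L) :
    bcMk φ L b (a • l) = bcMk φ L (b * φ a) l :=
  ((Submodule.Quotient.eq (bcRel φ L)).2 (Submodule.subset_span ⟨b, a, l, rfl⟩)).symm

theorem bc_induction {φ : A ⟶ B} {L : ModC A} {p : baseChange φ L → Prop}
    (h : ∀ b l, p (bcMk φ L b l)) (hadd : ∀ x y, p x → p y → p (x + y)) (x : baseChange φ L) :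
    p x := by
  obtain ⟨x, rfl⟩ := Submodule.Quotient.mk_surjective _ x
  induction x with
  | zero => simpa [bcMk] using h 0 0
  | tmul b l => exact h b l
  | add x y hx hy => exact hadd _ _ hx hy

/-- `l ↦ 1 ⊗ l`. -/
def bcInl (φ : A ⟶ B) (L : ModC A) : L →ₗ[k] baseChange φ L where
  toFun l := bcMk φ L 1 l
  map_add' l l' := congrArg (Submodule.Quotient.mk (p := bcRel φ L)) (TensorProduct.tmul_add 1 l l')
  map_smul' c l := congrArg (Submodule.Quotient.mk (p := bcRel φ L)) (TensorProduct.tmul_smul c 1 l)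

/-- The `B`-linear map `b ⊗ l ↦ b f(l)` on the base change. -/
def bcLift (φ : A ⟶ B) (L : ModC A) {W : Type*} [AddCommGroup W] [Module k W] [Module B W]
    [IsScalarTower k B W] (f : L →ₗ[k] W) (hf : ∀ (a : A) l, f (a • l) = φ a • f l) :
    baseChange φ L →ₗ[B] W :=
  (bcRel φ L).liftQ
    (TensorProduct.AlgebraTensorModule.lift
      (LinearMap.mk₂' B k (fun (b : B) (l : L) => b • f l)
        (fun b b' l => add_smul b b' _) (fun c b l => mul_smul c b _)
        (fun b l l' => by rw [map_add, smul_add])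
        (fun c b l => by rw [map_smul, smul_comm]))) (by
    rw [bcRel, Submodule.span_le]
    rintro _ ⟨b, a, l, rfl⟩
    simp [hf, mul_smul])

theorem bcLift_mk (φ : A ⟶ B) (L : ModC A) {W : Type*} [AddCommGroup W] [Module k W] [Module B W]
    [IsScalarTower k B W] (f : L →ₗ[k] W) (hf : ∀ (a : A) l, f (a • l) = φ a • f l) (b : B) (l : L) :
    bcLift φ L f hf (bcMk φ L b l) = b • f l := rfl

/-- The class of `m ⊗ n`. -/
def tMk (M N : ModC A) (m : M) (n : N) : tensor M N := Submodule.Quotient.mk (m ⊗ₜ[k] n)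

theorem D_tMk (M N : ModC A) (m : M) (n : N) :
    D k (tMk M N m n) = tMk M N (D k m) n + tMk M N m (D k n) := rfl

theorem smul_tMk (M N : ModC A) (a : A) (m : M) (n : N) :
    a • (tMk M N m n) = tMk M N (a • m) n := rfl

theorem tMk_add (M N : ModC A) (m : M) (n n' : N) :
    tMk M N m (n + n') = tMk M N m n + tMk M N m n' :=
  congrArg (Submodule.Quotient.mk (p := tensorRel M N)) (TensorProduct.tmul_add m n n')

theorem add_tMk (M N : ModC A) (m m' : M) (n : N) :
    tMk M N (m + m') n = tMk M N m n + tMk M N m' n :=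
  congrArg (Submodule.Quotient.mk (p := tensorRel M N)) (TensorProduct.add_tmul m m' n)

theorem tMk_smul' (M N : ModC A) (c : k) (m : M) (n : N) :
    tMk M N m (c • n) = c • tMk M N m n :=
  congrArg (Submodule.Quotient.mk (p := tensorRel M N)) (TensorProduct.tmul_smul c m n)

theorem tMk_smul (M N : ModC A) (a : A) (m : M) (n : N) :
    tMk M N m (a • n) = tMk M N (a • m + D k a • D k m) n :=
  ((Submodule.Quotient.eq (tensorRel M N)).2 (Submodule.subset_span ⟨m, a, n, rfl⟩)).symm

theorem t_induction {M N : ModC A} {p : tensor M N → Prop}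
    (h : ∀ m n, p (tMk M N m n)) (hadd : ∀ x y, p x → p y → p (x + y)) (x : tensor M N) :
    p x := by
  obtain ⟨x, rfl⟩ := Submodule.Quotient.mk_surjective _ x
  induction x with
  | zero => simpa [tMk] using h 0 0
  | tmul b l => exact h b l
  | add x y hx hy => exact hadd _ _ hx hy

/-- The map out of `M ⊗_A N` given by a balanced map. -/
def tLift (M N : ModC A) {W : Type*} [AddCommGroup W] [Module k W] [Module A W]
    [IsScalarTower k A W] (f : M →ₗ[A] N →ₗ[k] W)
    (hf : ∀ (a : A) m n, f m (a • n) = f (a • m + D k a • D k m) n) :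
    tensor M N →ₗ[A] W :=
  (tensorRel M N).liftQ (TensorProduct.AlgebraTensorModule.lift f) (by
    rw [tensorRel, Submodule.span_le]
    rintro _ ⟨m, a, n, rfl⟩
    simp only [SetLike.mem_coe, LinearMap.mem_ker, map_sub,
      TensorProduct.AlgebraTensorModule.lift_tmul, hf, sub_self])

theorem tLift_mk (M N : ModC A) {W : Type*} [AddCommGroup W] [Module k W] [Module A W]
    [IsScalarTower k A W] (f : M →ₗ[A] N →ₗ[k] W)
    (hf : ∀ (a : A) m n, f m (a • n) = f (a • m + D k a • D k m) n) (m : M) (n : N) :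
    tLift M N f hf (tMk M N m n) = f m n := rfl

/-- A bijective morphism is an isomorphism. -/
theorem Iso.nonempty_of_bijective {M N : ModC A} (f : Hom M N)
    (hf : Function.Bijective f.toLinearMap) : Nonempty (Iso N M) :=
  ⟨{ (LinearEquiv.ofBijective f.toLinearMap hf).symm with
     map_D := fun n => by
      apply hf.1
      obtain ⟨m, rfl⟩ := hf.2 n
      change f.toLinearMap ((LinearEquiv.ofBijective f.toLinearMap hf).symm (D k (f.toLinearMap m)))
        = f.toLinearMap (D k ((LinearEquiv.ofBijective f.toLinearMap hf).symm (f.toLinearMap m)))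
      have e : D k (f.toLinearMap m) = f.toLinearMap (D k m) := (f.map_D m).symm
      rw [e]
      have e' : ∀ m, (LinearEquiv.ofBijective f.toLinearMap hf).symm (f.toLinearMap m) = m :=
        fun m => (LinearEquiv.ofBijective f.toLinearMap hf).symm_apply_apply m
      rw [e', e'] }⟩

/-- Restriction of scalars. -/
def restrict (φ : A ⟶ B) (N : ModC B) : ModC A :=
  letI : Module A N := Module.compHom N (φ.toAlgHom : A →+* B)
  { carrier := N
    tower := ⟨fun c a n => by
      change φ (c • a) • n = c • (φ a • n)
      rw [map_smul, smul_assoc]⟩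
    isMod := ⟨fun a n => by
      change D k (φ a • n) = φ (D k a) • n + φ a • D k n
      rw [IsMod.D_smul (k := k), AlgC.map_D]⟩ }

theorem restrict_smul (φ : A ⟶ B) (N : ModC B) (a : A) (n : N) :
    (show N from (a • (show restrict φ N from n))) = φ a • n := rfl

section inv
variable (φ : A ⟶ B) {L N : ModC A} (e : Iso (tensor L N) (self A))

def pairing (l : L) (n : N) : A := e.toLinearEquiv (tMk L N l n)

theorem pairing_add (l : L) (n n' : N) :
    pairing e l (n + n') = pairing e l n + pairing e l n' := by
  rw [pairing, tMk_add]; exact map_add _ _ _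

theorem add_pairing (l l' : L) (n : N) :
    pairing e (l + l') n = pairing e l n + pairing e l' n := by
  rw [pairing, add_tMk]; exact map_add _ _ _

theorem zero_pairing (n : N) : pairing e 0 n = 0 := by
  simpa using add_pairing e 0 0 n

theorem smul_pairing (a : A) (l : L) (n : N) :
    pairing e (a • l) n = a * pairing e l n := by
  rw [pairing, ← smul_tMk]; exact map_smul e.toLinearEquiv _ _

theorem pairing_smul (a : A) (l : L) (n : N) :
    pairing e l (a • n) = a * pairing e l n + D k a * pairing e (D k l) n := by
  rw [pairing, tMk_smul, add_tMk, ← smul_pairing, ← smul_pairing]; exact map_add _ _ _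

theorem pairing_smul' (c : k) (l : L) (n : N) :
    pairing e l (c • n) = c • pairing e l n := by
  rw [pairing, tMk_smul']
  exact (e.toLinearEquiv.toLinearMap.restrictScalars k).map_smul c _

theorem smul_pairing' (c : k) (l : L) (n : N) :
    pairing e (c • l) n = c • pairing e l n := by
  rw [← algebraMap_smul A c l, smul_pairing, Algebra.smul_def]

theorem D_mul_comm (a b : A) : D k a * b = b * D k a := by
  simpa using (mul_comm' k b (D k a))

def pairBase (l : L) : B ⊗[k] N →ₗ[k] B :=
  TensorProduct.lift (LinearMap.mk₂ k
    (fun (b : B) (n : N) => b * φ (pairing e l n) + D k b * φ (pairing e (D k l) n))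
    (fun b b' n => by simp only [map_add, add_mul]; abel)
    (fun c b n => by simp only [map_smul, smul_mul_assoc, smul_add])
    (fun b n n' => by simp only [pairing_add, map_add, mul_add]; abel)
    (fun c b n => by simp only [pairing_smul', map_smul, mul_smul_comm, smul_add]))

theorem pairBase_rel (l : L) (x : B ⊗[k] N) (hx : x ∈ bcRel φ N) : pairBase φ e l x = 0 := by
  have : ∀ b : B, pairBase φ e l (b • x) = 0 := by
    rw [bcRel] at hx
    induction hx using Submodule.span_induction with
    | mem x hx =>
      obtain ⟨b, a, n, rfl⟩ := hx
      intro c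
      simp only [smul_sub, TensorProduct.smul_tmul', smul_eq_mul, map_sub, pairBase,
        TensorProduct.lift.tmul, LinearMap.mk₂_apply, pairing_smul, map_add, map_mul, D_D, zero_pairing, mul_zero,
        add_zero, D_mul, AlgC.map_D, mul_add, add_mul, mul_assoc]
      abel
    | zero => simp
    | add x y _ _ hx hy => intro b; rw [smul_add, map_add, hx, hy, add_zero]
    | smul a x _ hx => intro b; rw [← mul_smul, hx]
  simpa using this 1

def pairBaseQ (l : L) : baseChange φ N →ₗ[k] B :=
  ((bcRel φ N).restrictScalars k).liftQ (pairBase φ e l) (fun x hx => pairBase_rel φ e l x hx) ∘ₗ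
    (Submodule.Quotient.restrictScalarsEquiv k (bcRel φ N)).symm.toLinearMap

theorem pairBaseQ_mk (l : L) (b : B) (n : N) : pairBaseQ φ e l (bcMk φ N b n) =
    b * φ (pairing e l n) + D k b * φ (pairing e (D k l) n) := rfl

def pairBaseL : L →ₗ[k] baseChange φ N →ₗ[k] B where
  toFun := pairBaseQ φ e
  map_add' l l' := by
    ext x
    induction x using bc_induction with
    | h b n => simp only [pairBaseQ_mk, LinearMap.add_apply, add_pairing, map_add, mul_add]; abel
    | hadd x y hx hy => rw [map_add, map_add, hx, hy]
  map_smul' c l := by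
    ext x
    induction x using bc_induction with
    | h b n => simp only [pairBaseQ_mk, LinearMap.smul_apply, smul_pairing', map_smul,
        mul_smul_comm, smul_add, RingHom.id_apply]
    | hadd x y hx hy => rw [map_add, map_add, hx, hy]

def pairLeft : baseChange φ L →ₗ[B] baseChange φ N →ₗ[k] B :=
  bcLift φ L (pairBaseL φ e) (fun a l => by
    ext x
    induction x using bc_induction with
    | h b n =>
      have h1 : b * φ a + D k b * D k (φ a) = φ a * b := mul_comm' k (φ a) b
      have h2 := D_mul_comm (k := k) b (φ a)
      change pairBaseQ φ e _ _ = φ a * pairBaseQ φ e l (bcMk φ N b n)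
      simp only [pairBaseQ_mk, IsMod.D_smul (k := k), add_pairing, smul_pairing, map_add, map_mul,
        mul_add, AlgC.map_D, ← mul_assoc, ← h1, add_mul, h2]
      abel
    | hadd x y hx hy => rw [map_add, map_add, hx, hy])

theorem pairLeft_mk (b c : B) (l : L) (n : N) :
    pairLeft φ e (bcMk φ L b l) (bcMk φ N c n) =
      b * (c * φ (pairing e l n) + D k c * φ (pairing e (D k l) n)) := rfl

def pairFull : tensor (baseChange φ L) (baseChange φ N) →ₗ[B] B :=
  tLift _ _ (pairLeft φ e) (fun a x y => by
    induction x using bc_induction with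
    | h b l =>
      induction y using bc_induction with
      | h c n =>
        have h1 : b * a + D k b * D k a = a * b := mul_comm' k a b
        have h2 := D_mul_comm (k := k) a b
        have h3 := D_mul_comm (k := k) a (D k b)
        simp only [mk_smul_bc, D_bcMk, smul_add, map_add, LinearMap.add_apply, pairLeft_mk,
          D_mul, D_D, add_mul, mul_add, ← mul_assoc, ← h1, h2, h3]
        simp only [zero_pairing, map_zero, mul_zero, add_zero]
        abel_nf
        simp only [two_smul, add_self k, add_zero]
      | hadd x y hx hy => rw [smul_add, map_add, map_add, hx, hy]
    | hadd x y hx hy =>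
      simp only [map_add, smul_add, LinearMap.add_apply] at hx hy ⊢
      rw [hx, hy]; abel)

theorem pairFull_mk (b c : B) (l : L) (n : N) :
    pairFull φ e (tMk _ _ (bcMk φ L b l) (bcMk φ N c n)) =
      b * (c * φ (pairing e l n) + D k c * φ (pairing e (D k l) n)) := rfl

def inlTensor (L N : ModC A) :
    tensor L N →ₗ[A] restrict φ (tensor (baseChange φ L) (baseChange φ N)) :=
  tLift L N (W := restrict φ (tensor (baseChange φ L) (baseChange φ N)))
    (LinearMap.mk₂' A k (fun (l : L) (n : N) =>
        (show restrict φ (tensor (baseChange φ L) (baseChange φ N)) from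
          tMk _ _ (bcInl φ L l) (bcInl φ N n)))
      (fun l l' n => by rw [map_add]; exact add_tMk _ _ _ _ _)
      (fun a l n => by
        change tMk _ _ (bcMk φ L 1 (a • l)) _ = φ a • tMk _ _ (bcMk φ L 1 l) _
        rw [bcMk_smul, smul_tMk, mk_smul_bc, one_mul, mul_one])
      (fun l n n' => by rw [map_add]; exact tMk_add _ _ _ _ _)
      (fun c l n => by rw [map_smul]; exact tMk_smul' _ _ _ _ _))
    (fun a l n => by
      change tMk (baseChange φ L) (baseChange φ N) (bcMk φ L 1 l) (bcMk φ N 1 (a • n)) =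
        tMk (baseChange φ L) (baseChange φ N)
          (bcInl φ L (a • l + D k a • D k l)) (bcMk φ N 1 n)
      rw [map_add]
      change _ = tMk (baseChange φ L) (baseChange φ N)
          (bcMk φ L 1 (a • l) + bcMk φ L 1 (D k a • D k l)) (bcMk φ N 1 n)
      have e1 : bcMk φ N 1 (a • n) = φ a • bcMk φ N 1 n := by
        rw [bcMk_smul, mk_smul_bc, one_mul, mul_one]
      rw [e1, tMk_smul, bcMk_smul, bcMk_smul, mk_smul_bc, D_bcMk, D_one, smul_add, mk_smul_bc,
        mk_smul_bc, AlgC.map_D]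
      have : bcMk φ L (D k (φ a) * 0) l = 0 := by
        rw [mul_zero]
        exact congrArg (Submodule.Quotient.mk (p := bcRel φ L)) (TensorProduct.zero_tmul _ _)
      rw [this, zero_add, one_mul, mul_one, mul_one, one_mul])

theorem inlTensor_mk (l : L) (n : N) :
    (show tensor (baseChange φ L) (baseChange φ N) from inlTensor φ L N (tMk L N l n)) =
      tMk _ _ (bcMk φ L 1 l) (bcMk φ N 1 n) := rfl

theorem inlTensor_D (x : tensor L N) :
    inlTensor φ L N (D k x) = D k (inlTensor φ L N x) := by
  have h0 : ∀ M : ModC A, ∀ l : M, bcMk φ M 1 (D k l) = D k (bcMk φ M 1 l) := fun M l => by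
    have : bcMk φ M 0 l = 0 :=
      congrArg (Submodule.Quotient.mk (p := bcRel φ M)) (TensorProduct.zero_tmul _ _)
    rw [D_bcMk, D_one, this, zero_add]
  induction x using t_induction with
  | h l n =>
    rw [D_tMk, map_add]
    change tMk _ _ (bcMk φ L 1 (D k l)) (bcMk φ N 1 n) + tMk _ _ (bcMk φ L 1 l) (bcMk φ N 1 (D k n))
      = D k (tMk _ _ (bcMk φ L 1 l) (bcMk φ N 1 n))
    rw [h0, h0, D_tMk]
  | hadd x y hx hy => rw [map_add, map_add, map_add, map_add, hx, hy]

/-- The generator of the tensor product corresponding to `1`. -/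
def bcGen : tensor (baseChange φ L) (baseChange φ N) :=
  inlTensor φ L N (e.toLinearEquiv.symm (1 : A))

theorem D_bcGen : D k (bcGen φ e) = 0 := by
  have h : e.toLinearEquiv (D k (e.toLinearEquiv.symm (1 : A))) = 0 := by
    refine (e.map_D _).trans ?_
    change D k (e.toLinearEquiv (e.toLinearEquiv.symm (1 : A))) = 0
    rw [LinearEquiv.apply_symm_apply]
    exact D_one k
  refine (inlTensor_D φ _).symm.trans ?_
  rw [(LinearEquiv.map_eq_zero_iff _).1 h, map_zero]
  rfl

theorem inlTensor_eq (x : tensor L N) :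
    (show tensor (baseChange φ L) (baseChange φ N) from inlTensor φ L N x) =
      φ (e.toLinearEquiv x) • bcGen φ e := by
  have h : x = (show A from e.toLinearEquiv x) • e.toLinearEquiv.symm (1 : A) := by
    apply e.toLinearEquiv.injective
    rw [map_smul, LinearEquiv.apply_symm_apply]
    exact (mul_one (show A from e.toLinearEquiv x)).symm
  conv_lhs => rw [h]
  rw [map_smul]
  rfl

theorem pairFull_inl (x : tensor L N) :
    pairFull φ e (inlTensor φ L N x) = φ (e.toLinearEquiv x) := by
  induction x using t_induction with
  | h l n =>
    refine (pairFull_mk φ e 1 1 l n).trans ?_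
    simp [pairing]
  | hadd x y hx hy =>
    rw [map_add]
    refine (map_add (pairFull φ e) _ _).trans ?_
    rw [hx, hy, map_add]
    exact (map_add φ _ _).symm

theorem baseChange_invertible {L : ModC A} (h : Invertible L) : Invertible (baseChange φ L) := by
  obtain ⟨N, ⟨e⟩⟩ := h
  refine ⟨baseChange φ N, Iso.nonempty_of_bijective
    { LinearMap.toSpanSingleton B (tensor (baseChange φ L) (baseChange φ N)) (bcGen φ e) with
      map_D := fun b => ?_ } ⟨?_, ?_⟩⟩
  · change B at b
    change D k b • bcGen φ e = D k (b • bcGen φ e)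
    rw [IsMod.D_smul (k := k), D_bcGen, smul_zero, add_zero]
  · intro b c hbc
    change B at b c
    have hbc : b • bcGen φ e = c • bcGen φ e := hbc
    have h := congrArg (pairFull φ e) hbc
    have h1 : pairFull φ e (bcGen φ e) = 1 := by
      rw [bcGen, pairFull_inl, LinearEquiv.apply_symm_apply]
      exact map_one φ
    simpa [map_smul, h1] using h
  · intro x
    suffices h : x ∈ LinearMap.range (LinearMap.toSpanSingleton B _ (bcGen φ e)) from h
    have key : ∀ (b : B) (l : L) (n : N),
        b • (tMk _ _ (bcMk φ L 1 l) (bcMk φ N 1 n)) ∈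
        LinearMap.range (LinearMap.toSpanSingleton B _ (bcGen φ e)) := fun b l n => by
      rw [← inlTensor_mk φ l n, inlTensor_eq φ e]
      exact ⟨b * φ (e.toLinearEquiv (tMk L N l n)), mul_smul _ _ _⟩
    have h0 : ∀ l : L, bcMk φ L 1 (D k l) = D k (bcMk φ L 1 l) := fun l => by
      have : bcMk φ L 0 l = 0 :=
        congrArg (Submodule.Quotient.mk (p := bcRel φ L)) (TensorProduct.zero_tmul _ _)
      rw [D_bcMk, D_one, this, zero_add]
    induction x using t_induction with
    | h y z =>
      induction y using bc_induction with
      | h b l =>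
        induction z using bc_induction with
        | h c n =>
          have e1 : bcMk φ N c n = c • bcMk φ N 1 n := by rw [mk_smul_bc, mul_one]
          have e2 : bcMk φ L b l = b • bcMk φ L 1 l := by rw [mk_smul_bc, mul_one]
          rw [e2, ← smul_tMk, e1, tMk_smul, ← h0, add_tMk, ← smul_tMk, ← smul_tMk]
          exact Submodule.smul_mem _ _ (add_mem (key _ _ _) (key _ _ _))
        | hadd z z' h h' => rw [tMk_add]; exact add_mem h h'
      | hadd z z' h h' => rw [add_tMk]; exact add_mem h h'
    | hadd z z' h h' => exact add_mem h h'

end inv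

/-- The base change of a morphism of modules. -/
def bcMap (φ : A ⟶ B) {M N : ModC A} (f : Hom M N) : baseChange φ M →ₗ[B] baseChange φ N :=
  bcLift φ M (bcInl φ N ∘ₗ f.toLinearMap.restrictScalars k) (fun a m => by
    change bcMk φ N 1 (f.toLinearMap (a • m)) = φ a • bcMk φ N 1 (f.toLinearMap m)
    rw [map_smul, bcMk_smul, mk_smul_bc, one_mul, mul_one])

section freeLift
variable {V : Type u} [AddCommGroup V] [Module k V]

/-- `a ⊗ v ↦ a g(v)`. -/
def freeLin (L : ModC A) (g : V →ₗ[k] L) : A ⊗[k] V →ₗ[A] L :=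
  TensorProduct.AlgebraTensorModule.lift
      (LinearMap.mk₂' A k (fun (a : A) (v : V) => a • g v)
        (fun b b' l => add_smul b b' _) (fun c b l => mul_smul c b _)
        (fun b l l' => by rw [map_add, smul_add])
        (fun c b l => by rw [map_smul, smul_comm]))

theorem freeLin_tmul (L : ModC A) (g : V →ₗ[k] L) (a : A) (v : V) :
    freeLin L g (a ⊗ₜ v) = a • g v := rfl

theorem freeLin_D [IndObj k V] (L : ModC A) (g : V →ₗ[k] L) (hg : ∀ v, g (D k v) = D k (g v))
    (x : A ⊗[k] V) : freeLin L g (D k x) = D k (freeLin L g x) := by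
  induction x with
  | zero => simp only [map_zero]
  | add x y hx hy => simp only [map_add, hx, hy]
  | tmul a v => simp only [D_tmul, map_add, freeLin_tmul, IsMod.D_smul (k := k), hg]

/-- The morphism `A ⊗ V ⟶ L` of `A`-modules extending a morphism `V ⟶ L`. -/
def freeLift [IndObj k V] (L : ModC A) (g : V →ₗ[k] L) (hg : ∀ v, g (D k v) = D k (g v)) :
    Hom (free A V) L where
  toLinearMap := freeLin L g
  map_D := freeLin_D L g hg

end freeLift

/-- The morphism `V ⟶ L`, `v ↦ p (1 ⊗ v)`. -/
def freeRes {V : Type u} [AddCommGroup V] [Module k V] [IndObj k V] {L : ModC A}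
    (p : Hom (free A V) L) : V →ₗ[k] L :=
  p.toLinearMap.restrictScalars k ∘ₗ TensorProduct.mk k A V 1

section freeRes
variable {V : Type u} [AddCommGroup V] [Module k V] [IndObj k V] {L : ModC A}
    (p : Hom (free A V) L)

theorem freeRes_apply (v : V) : freeRes p v = p.toLinearMap ((1 : A) ⊗ₜ[k] v) := rfl

theorem freeRes_D (v : V) : freeRes p (D k v) = D k (freeRes p v) := by
  have h := p.map_D ((1 : A) ⊗ₜ[k] v)
  have e : D k ((1 : A) ⊗ₜ[k] v) = 1 ⊗ₜ[k] D k v := by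
    rw [D_tmul, D_one, TensorProduct.zero_tmul, zero_add]
  rw [e] at h
  exact h

theorem apply_tmul (a : A) (v : V) : p.toLinearMap (a ⊗ₜ[k] v) = a • freeRes p v := by
  rw [freeRes_apply, ← map_smul]
  congr 1
  change _ = (a * 1) ⊗ₜ[k] v
  rw [mul_one]

theorem bcInl_D (φ : A ⟶ B) (l : L) : bcInl φ L (D k l) = D k (bcInl φ L l) := by
  have : bcMk φ L 0 l = 0 :=
    congrArg (Submodule.Quotient.mk (p := bcRel φ L)) (TensorProduct.zero_tmul _ _)
  change bcMk φ L 1 (D k l) = D k (bcMk φ L 1 l)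
  rw [D_bcMk, D_one, this, zero_add]

end freeRes

end ModC

open ModC

section proj
variable {k : Type u} [Field k] [CharP k 2]

/-- An epimorphism `A ⊗ X^* ↠ L` onto an invertible `A`-module `L`. -/
structure ProjPoint (A : AlgC k) (X : Type u) [AddCommGroup X] [Module k X] [IndObj k X] where
  L : ModC A
  invertible : Invertible L
  p : Hom (free A (Module.Dual k X)) L
  surjective : Function.Surjective p.toLinearMap

namespace ProjPoint
variable {A B C : AlgC k} {X : Type u} [AddCommGroup X] [Module k X] [IndObj k X]

/-- Two such are equivalent if there is an isomorphism of modules making the triangle commute. -/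
def Rel (x y : ProjPoint A X) : Prop :=
  ∃ e : Iso x.L y.L, ∀ v, e.toLinearEquiv (x.p.toLinearMap v) = y.p.toLinearMap v

theorem hom_ext_of {x y : ProjPoint A X} (f : x.L →ₗ[A] y.L)
    (hf : ∀ v, f (freeRes x.p v) = freeRes y.p v)
    (v : A ⊗[k] Module.Dual k X) : f (x.p.toLinearMap v) = y.p.toLinearMap v := by
  induction v with
  | zero => rw [map_zero, map_zero, map_zero]
  | add v w hv hw => rw [map_add, map_add, map_add, hv, hw]
  | tmul a v => rw [apply_tmul, apply_tmul, map_smul, hf]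

theorem rel_of {x y : ProjPoint A X} (f : x.L →ₗ[A] y.L) (g : y.L →ₗ[A] x.L)
    (hf : ∀ v, f (freeRes x.p v) = freeRes y.p v)
    (hg : ∀ v, g (freeRes y.p v) = freeRes x.p v) : Rel x y := by
  have hf' := hom_ext_of f hf
  have hg' := hom_ext_of g hg
  refine ⟨{ f with invFun := g, left_inv := fun l => ?_, right_inv := fun l => ?_,
                   map_D := fun l => ?_ }, hf'⟩
  · obtain ⟨v, rfl⟩ := x.surjective l
    exact (congrArg g (hf' v)).trans (hg' v)
  · obtain ⟨v, rfl⟩ := y.surjective l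
    exact (congrArg f (hg' v)).trans (hf' v)
  · obtain ⟨v, rfl⟩ := x.surjective l
    change f (D k (x.p.toLinearMap v)) = D k (f (x.p.toLinearMap v))
    have h1 : D k (x.p.toLinearMap v) = x.p.toLinearMap (D k v) := (x.p.map_D v).symm
    have h2 : D k (y.p.toLinearMap v) = y.p.toLinearMap (D k v) := (y.p.map_D v).symm
    have h3 := hf' v
    have h4 := hf' (D k v)
    rw [h1]
    exact h4.trans (h2.symm.trans (congrArg _ h3.symm))

theorem Rel.refl (x : ProjPoint A X) : Rel x x :=
  rel_of LinearMap.id LinearMap.id (fun _ => rfl) (fun _ => rfl)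

theorem Rel.symm {x y : ProjPoint A X} : Rel x y → Rel y x := by
  rintro ⟨e, he⟩
  exact rel_of e.symm.toLinearMap e.toLinearMap
    (fun v => (LinearEquiv.symm_apply_eq e.toLinearEquiv).2 (he _).symm) (fun v => he _)

theorem Rel.trans {x y z : ProjPoint A X} : Rel x y → Rel y z → Rel x z := by
  rintro ⟨e, he⟩ ⟨f, hf⟩
  have he' : ∀ v, e.toLinearEquiv.symm (y.p.toLinearMap v) = x.p.toLinearMap v :=
    fun v => (LinearEquiv.symm_apply_eq e.toLinearEquiv).2 (he v).symm
  have hf' : ∀ v, f.toLinearEquiv.symm (z.p.toLinearMap v) = y.p.toLinearMap v :=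
    fun v => (LinearEquiv.symm_apply_eq f.toLinearEquiv).2 (hf v).symm
  exact rel_of (f.toLinearEquiv.toLinearMap ∘ₗ e.toLinearEquiv.toLinearMap)
    (e.toLinearEquiv.symm.toLinearMap ∘ₗ f.toLinearEquiv.symm.toLinearMap)
    (fun v => (congrArg f.toLinearEquiv (he _)).trans (hf _))
    (fun v => (congrArg e.toLinearEquiv.symm (hf' _)).trans (he' _))

instance setoid (A : AlgC k) (X : Type u) [AddCommGroup X] [Module k X] [IndObj k X] :
    Setoid (ProjPoint A X) := ⟨Rel, Rel.refl, Rel.symm, Rel.trans⟩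

/-- The base change `B ⊗ X^* = B ⊗_A (A ⊗ X^*) ↠ B ⊗_A L`, which sends `b ⊗ x` to
`b ⊗ p(1 ⊗ x)`. -/
def baseChange (φ : A ⟶ B) (x : ProjPoint A X) : ProjPoint B X where
  L := ModC.baseChange φ x.L
  invertible := baseChange_invertible φ x.invertible
  p := freeLift _ (bcInl φ x.L ∘ₗ freeRes x.p) (fun v => by
    change bcInl φ x.L (freeRes x.p (D k v)) = D k (bcInl φ x.L (freeRes x.p v))
    rw [freeRes_D, bcInl_D])
  surjective := fun y => by
    suffices h : y ∈ LinearMap.range (freeLin (ModC.baseChange φ x.L)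
      (bcInl φ x.L ∘ₗ freeRes x.p)) from h
    induction y using bc_induction with
    | hadd y z hy hz => exact add_mem hy hz
    | h b l =>
      have e2 : bcMk φ x.L b l = b • bcMk φ x.L 1 l := by rw [mk_smul_bc, mul_one]
      rw [e2]
      refine Submodule.smul_mem _ _ ?_
      obtain ⟨v, rfl⟩ := x.surjective l
      change A ⊗[k] Module.Dual k X at v
      suffices h : ∀ v : A ⊗[k] Module.Dual k X, bcInl φ x.L (x.p.toLinearMap v) ∈
        LinearMap.range (freeLin (ModC.baseChange φ x.L) (bcInl φ x.L ∘ₗ freeRes x.p)) from h v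
      intro v
      induction v with
      | zero => rw [map_zero, map_zero]; exact zero_mem _
      | add v w hv hw => rw [map_add, map_add]; exact add_mem hv hw
      | tmul a v =>
        refine ⟨φ a ⊗ₜ v, ?_⟩
        rw [freeLin_tmul, apply_tmul]
        change φ a • bcMk φ x.L 1 _ = bcMk φ x.L 1 (a • _)
        rw [mk_smul_bc, bcMk_smul, one_mul, mul_one]

theorem freeRes_baseChange (φ : A ⟶ B) (x : ProjPoint A X) (v : Module.Dual k X) :
    freeRes (x.baseChange φ).p v = bcMk φ x.L 1 (freeRes x.p v) :=
  one_smul B (bcMk φ x.L 1 (freeRes x.p v))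

theorem bcInl_smul (φ : A ⟶ B) (L : ModC A) (a : A) (l : L) :
    bcInl φ L (a • l) = φ a • bcInl φ L l := by
  change bcMk φ L 1 (a • l) = φ a • bcMk φ L 1 l
  rw [mk_smul_bc, bcMk_smul, one_mul, mul_one]

theorem baseChange_rel (φ : A ⟶ B) {x y : ProjPoint A X} :
    Rel x y → Rel (x.baseChange φ) (y.baseChange φ) := by
  rintro ⟨e, he⟩
  have he' : ∀ v, e.toLinearEquiv.symm (y.p.toLinearMap v) = x.p.toLinearMap v :=
    fun v => (LinearEquiv.symm_apply_eq e.toLinearEquiv).2 (he v).symm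
  refine rel_of (bcLift φ x.L (W := ModC.baseChange φ y.L) (bcInl φ y.L ∘ₗ e.toLinearEquiv.toLinearMap.restrictScalars k) ?_)
    (bcLift φ y.L (W := ModC.baseChange φ x.L) (bcInl φ x.L ∘ₗ e.toLinearEquiv.symm.toLinearMap.restrictScalars k) ?_) ?_ ?_
  · intro a l
    exact (congrArg (bcInl φ y.L) (map_smul e.toLinearEquiv a l)).trans (bcInl_smul _ _ _ _)
  · intro a l
    exact (congrArg (bcInl φ x.L) (map_smul e.toLinearEquiv.symm a l)).trans (bcInl_smul _ _ _ _)
  · intro v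
    rw [freeRes_baseChange, freeRes_baseChange]
    exact (one_smul B (bcInl φ y.L (e.toLinearEquiv (freeRes x.p v)))).trans
      (congrArg (bcInl φ y.L) (he _))
  · intro v
    rw [freeRes_baseChange, freeRes_baseChange]
    exact (one_smul B (bcInl φ x.L (e.toLinearEquiv.symm (freeRes y.p v)))).trans
      (congrArg (bcInl φ x.L) (he' _))

theorem baseChange_id (x : ProjPoint A X) : Rel (x.baseChange (𝟙 A)) x := by
  refine rel_of (bcLift (𝟙 A) x.L LinearMap.id (fun a l => rfl))
    { bcInl (𝟙 A) x.L with map_smul' := fun a l => bcInl_smul (𝟙 A) x.L a l } ?_ ?_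
  · intro v
    rw [freeRes_baseChange]
    exact one_smul A (freeRes x.p v)
  · intro v
    rw [freeRes_baseChange]
    rfl

def bcCompAux (φ : A ⟶ B) (ψ : B ⟶ C) (L : ModC A) :
    ModC.baseChange φ L →ₗ[B] restrict ψ (ModC.baseChange (φ ≫ ψ) L) :=
  bcLift φ L (W := restrict ψ (ModC.baseChange (φ ≫ ψ) L))
    (bcInl (φ ≫ ψ) L) (fun a l => bcInl_smul (φ ≫ ψ) L a l)

def bcCompInv (φ : A ⟶ B) (ψ : B ⟶ C) (L : ModC A) :
    ModC.baseChange ψ (ModC.baseChange φ L) →ₗ[C] ModC.baseChange (φ ≫ ψ) L :=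
  bcLift ψ (ModC.baseChange φ L) (W := ModC.baseChange (φ ≫ ψ) L)
    ((bcCompAux φ ψ L).restrictScalars k) (fun b y => map_smul (bcCompAux φ ψ L) b y)

theorem bcCompInv_mk (φ : A ⟶ B) (ψ : B ⟶ C) (L : ModC A) (l : L) :
    bcCompInv φ ψ L (bcMk ψ _ 1 (bcMk φ L 1 l)) = bcMk (φ ≫ ψ) L 1 l := by
  have h1 : bcCompInv φ ψ L (bcMk ψ _ 1 (bcMk φ L 1 l)) =
      (show ModC.baseChange (φ ≫ ψ) L from bcCompAux φ ψ L (bcMk φ L 1 l)) :=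
    one_smul C (show ModC.baseChange (φ ≫ ψ) L from bcCompAux φ ψ L (bcMk φ L 1 l))
  have h2 : bcCompAux φ ψ L (bcMk φ L 1 l) =
      (show restrict ψ (ModC.baseChange (φ ≫ ψ) L) from bcInl (φ ≫ ψ) L l) :=
    one_smul B (show restrict ψ (ModC.baseChange (φ ≫ ψ) L) from bcInl (φ ≫ ψ) L l)
  exact h1.trans h2

theorem baseChange_comp (φ : A ⟶ B) (ψ : B ⟶ C) (x : ProjPoint A X) :
    Rel (x.baseChange (φ ≫ ψ)) ((x.baseChange φ).baseChange ψ) := by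
  refine rel_of (bcLift (φ ≫ ψ) x.L (W := ModC.baseChange ψ (ModC.baseChange φ x.L)) (bcInl ψ _ ∘ₗ bcInl φ x.L) (fun a l => ?_))
    (bcCompInv φ ψ x.L) ?_ ?_
  · change bcInl ψ _ (bcInl φ x.L (a • l)) = _
    rw [bcInl_smul, bcInl_smul]
    rfl
  · intro v
    rw [freeRes_baseChange, freeRes_baseChange, freeRes_baseChange]
    exact one_smul C (bcMk ψ (ModC.baseChange φ x.L) 1 (bcMk φ x.L 1 (freeRes x.p v)))
  · intro v
    rw [freeRes_baseChange, freeRes_baseChange, freeRes_baseChange]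
    exact bcCompInv_mk φ ψ x.L (freeRes x.p v)

end ProjPoint

/-- The projective space of an object `X`, as a functor on algebras: it sends `A` to the set of
equivalence classes of epimorphisms `A ⊗ X^* ↠ L` with `L` an invertible `A`-module. -/
def projSpace (k : Type u) [Field k] [CharP k 2] (X : Type u) [AddCommGroup X] [Module k X]
    [IndObj k X] [Module.Finite k X] : AlgC k ⥤ Type (u + 1) where
  obj A := Quotient (ProjPoint.setoid A X)
  map φ := ↾(Quotient.map (ProjPoint.baseChange φ) (fun _ _ h => ProjPoint.baseChange_rel φ h))
  map_id A := by
    ext x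
    obtain ⟨x, rfl⟩ := Quotient.exists_rep x
    exact Quotient.sound x.baseChange_id
  map_comp φ ψ := by
    ext x
    obtain ⟨x, rfl⟩ := Quotient.exists_rep x
    exact Quotient.sound (x.baseChange_comp φ ψ)

/-- `B ⊗_A -` is exact (equivalently, preserves monomorphisms, being right exact). -/
def Flat {A B : AlgC k} (φ : A ⟶ B) : Prop :=
  ∀ (M N : ModC A) (f : ModC.Hom M N), Function.Injective f.toLinearMap →
    Function.Injective (bcMap φ f)

/-- Flat, and `B ⊗_A M = 0` only if `M = 0`. -/
def FaithfullyFlat {A B : AlgC k} (φ : A ⟶ B) : Prop :=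
  Flat φ ∧ ∀ M : ModC A, Subsingleton (baseChange φ M) → Subsingleton M

/-- The sheaf condition for the fpqc pretopology, whose covers are the finite families `A → B i`
for which `A → ∏ i, B i` is faithfully flat: a family of elements of the `F (B i)` which is
compatible on every algebra under `B i` and `B j` that agrees on `A` (equivalently, on
`B i ⊗_A B j`) comes from exactly one element of `F A`. -/
def IsFaisceau : ObjectProperty (AlgC k ⥤ Type (u + 1)) := fun F =>
  ∀ (ι : Type) [Finite ι] (A : AlgC k) (B : ι → AlgC k) (φ : ∀ i, A ⟶ B i),
    FaithfullyFlat (AlgC.prodLift B φ) →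
    ∀ x : ∀ i, F.obj (B i),
      (∀ (i j : ι) (C : AlgC k) (f : B i ⟶ C) (g : B j ⟶ C), φ i ≫ f = φ j ≫ g →
        F.map f (x i) = F.map g (x j)) →
      ∃! y : F.obj A, ∀ i, F.map (φ i) y = x i

/-- The category of fpqc sheaves (faisceaux), a full subcategory of the functors to sets. -/
abbrev Fais (k : Type u) [Field k] [CharP k 2] := (IsFaisceau (k := k)).FullSubcategory

/-- The functor of points `Hom(A, -)` of the affine scheme `Spec A`, the object of the opposite
category of algebras given by `A`. -/
def Phi (A : AlgC k) : AlgC k ⥤ Type (u + 1) := uliftCoyoneda.{u + 1}.obj (Opposite.op A)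

end proj

section T
open Polynomial
variable (k : Type u) [Field k]

/-- The indecomposable projective object `P`, with `D v₁ = v₂` and `D v₂ = 0`. -/
def P : Type u := k × k
instance : AddCommGroup (P k) := inferInstanceAs (AddCommGroup (k × k))
instance : Module k (P k) := inferInstanceAs (Module k (k × k))
instance : Module.Finite k (P k) := inferInstanceAs (Module.Finite k (k × k))

instance : IndObj k (P k) where
  D := LinearMap.inr k k k ∘ₗ LinearMap.fst k k k
  D_D v := by
    change ((0 : k), (0 : k)) = 0
    rfl

def P.v₁ : P k := ((1 : k), (0 : k))
def P.v₂ : P k := ((0 : k), (1 : k))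
theorem P.D_v₁ : D k (P.v₁ k) = P.v₂ k := rfl

/-- An isomorphism `P ≅ P^*`, given by `v₁ ↦ v₂^*` and `v₂ ↦ v₁^*`. -/
def P.selfDual : ObjIso k (P k) (Module.Dual k (P k)) where
  toFun v := v.1 • LinearMap.snd k k k + v.2 • LinearMap.fst k k k
  map_add' v w := by
    change (v.1 + w.1) • _ + (v.2 + w.2) • _ = _
    rw [add_smul, add_smul]
    abel
  map_smul' c v := by
    refine LinearMap.ext fun x => ?_
    change c * v.1 * x.2 + c * v.2 * x.1 = c * (v.1 * x.2 + v.2 * x.1)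
    ring
  invFun f := (f (P.v₂ k), f (P.v₁ k))
  left_inv v := by
    change ((v.1 * 1 + v.2 * 0 : k), (v.1 * 0 + v.2 * 1 : k)) = (v.1, v.2)
    simp
  right_inv f := by
    have key : ∀ x : P k, f x = x.1 * f (P.v₁ k) + x.2 * f (P.v₂ k) := fun x => by
      have hx : x = x.1 • P.v₁ k + x.2 • P.v₂ k := by
        change (x.1, x.2) = ((x.1 * 1 + x.2 * 0 : k), (x.1 * 0 + x.2 * 1 : k))
        simp
      exact (congrArg f hx).trans ((map_add f _ _).trans
        (congrArg₂ (· + ·) (map_smul f _ _) (map_smul f _ _)))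
    refine LinearMap.ext fun x => Eq.trans ?_ (key x).symm
    change f (P.v₂ k) * x.2 + f (P.v₁ k) * x.1 = x.1 * f (P.v₁ k) + x.2 * f (P.v₂ k)
    ring
  map_D v := by
    refine LinearMap.ext fun x => ?_
    change (0 : k) * x.2 + v.1 * x.1 = v.1 * x.1 + v.2 * 0
    ring

/-- The ring `k[t]/t⁴`. -/
def TRing : Type u := k[X] ⧸ Ideal.span {(X : k[X]) ^ 4}
instance : CommRing (TRing k) := inferInstanceAs (CommRing (k[X] ⧸ Ideal.span {(X : k[X]) ^ 4}))
instance : Algebra k (TRing k) := inferInstanceAs (Algebra k (k[X] ⧸ Ideal.span {(X : k[X]) ^ 4}))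

/-- The quotient map. -/
def TRing.mk : k[X] →ₐ[k] TRing k := Ideal.Quotient.mkₐ k (Ideal.span {(X : k[X]) ^ 4})

/-- The class `t` of `X`. -/
def TRing.t : TRing k := TRing.mk k X

theorem TRing.mk_surjective : Function.Surjective (TRing.mk k) := Ideal.Quotient.mk_surjective

theorem TRing.mk_eq_zero {p : k[X]} : TRing.mk k p = 0 ↔ X ^ 4 ∣ p :=
  Ideal.Quotient.eq_zero_iff_mem.trans Ideal.mem_span_singleton

theorem TRing.D_aux (p : k[X]) (hp : TRing.mk k p = 0) :
    TRing.mk k (X ^ 2 * derivative p) = 0 := by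
  rw [TRing.mk_eq_zero] at hp ⊢
  obtain ⟨q, rfl⟩ := hp
  refine ⟨X * 4 * q + X ^ 2 * derivative q, ?_⟩
  rw [derivative_mul, derivative_X_pow]
  have h4 : (C ((4 : ℕ) : k) : k[X]) = 4 :=
    (map_natCast C 4).trans Nat.cast_ofNat
  rw [h4]
  ring

/-- The map `p ↦ X² p'` to the quotient. -/
def TRing.polyD : k[X] →ₗ[k] TRing k :=
  (TRing.mk k).toLinearMap ∘ₗ LinearMap.mulLeft k (X ^ 2) ∘ₗ derivative

/-- The derivation of `k[t]/t⁴` with `D t = t²`. -/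
def TRing.D : TRing k →ₗ[k] TRing k :=
  (LinearMap.ker (TRing.mk k).toLinearMap).liftQ (TRing.polyD k) (fun p hp => TRing.D_aux k p hp) ∘ₗ
    ((TRing.mk k).toLinearMap.quotKerEquivOfSurjective (TRing.mk_surjective k)).symm.toLinearMap

theorem TRing.D_mk (p : k[X]) :
    TRing.D k (TRing.mk k p) = TRing.mk k (X ^ 2 * derivative p) := by
  have h : ((TRing.mk k).toLinearMap.quotKerEquivOfSurjective (TRing.mk_surjective k)).symm
      (TRing.mk k p) = Submodule.Quotient.mk p := by
    rw [LinearEquiv.symm_apply_eq]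
    rfl
  change (LinearMap.ker (TRing.mk k).toLinearMap).liftQ (TRing.polyD k) (fun p hp => TRing.D_aux k p hp)
    (((TRing.mk k).toLinearMap.quotKerEquivOfSurjective (TRing.mk_surjective k)).symm
      (TRing.mk k p)) = _
  rw [h]
  rfl

theorem TRing.t_pow_four : TRing.t k ^ 4 = 0 := by
  rw [TRing.t, ← map_pow, TRing.mk_eq_zero]

theorem TRing.D_t : TRing.D k (TRing.t k) = TRing.t k ^ 2 := by
  rw [TRing.t, TRing.D_mk, derivative_X, mul_one, map_pow]

theorem TRing.D_mul (a b : TRing k) :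
    TRing.D k (a * b) = TRing.D k a * b + a * TRing.D k b := by
  obtain ⟨p, rfl⟩ := TRing.mk_surjective k a
  obtain ⟨q, rfl⟩ := TRing.mk_surjective k b
  rw [← map_mul, TRing.D_mk, TRing.D_mk, TRing.D_mk, ← map_mul, ← map_mul, ← map_add,
    derivative_mul]
  congr 1
  ring

theorem TRing.D_mul_D (a b : TRing k) : TRing.D k a * TRing.D k b = 0 := by
  obtain ⟨p, rfl⟩ := TRing.mk_surjective k a
  obtain ⟨q, rfl⟩ := TRing.mk_surjective k b
  rw [TRing.D_mk, TRing.D_mk, ← map_mul, TRing.mk_eq_zero]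
  exact ⟨derivative p * derivative q, by ring⟩

theorem TRing.add_self [CharP k 2] (a : TRing k) : a + a = 0 := Ver4.add_self k a

theorem TRing.D_D [CharP k 2] (a : TRing k) : TRing.D k (TRing.D k a) = 0 := by
  obtain ⟨p, rfl⟩ := TRing.mk_surjective k a
  rw [TRing.D_mk, TRing.D_mk, TRing.mk_eq_zero]
  have h2 : (2 : k[X]) = 0 := CharTwo.two_eq_zero
  refine ⟨derivative (derivative p), ?_⟩
  have hC : (C ((2 : ℕ) : k) : k[X]) = 2 :=
    (map_natCast C 2).trans Nat.cast_ofNat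
  rw [derivative_mul, derivative_X_pow, hC, h2]
  ring

variable [CharP k 2]

instance : ComAlg k (TRing k) where
  D := TRing.D k
  D_D := TRing.D_D k
  D_mul' := by
    ext a b
    exact TRing.D_mul k a b
  mul_braid := by
    ext a b
    change b * a + TRing.D k b * TRing.D k a = a * b
    rw [TRing.D_mul_D, add_zero, mul_comm]

/-- The algebra `T = k[t]/t⁴` with `D t = t²`. -/
def T : AlgC k := ⟨TRing k⟩

/-- An element of `k[t]/t⁴` as an element of `T`. -/
def T.of (a : TRing k) : T k := a

/-- The regular module of `k[t]/t⁴` with the action of `D` for which `D 1 = c`. -/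
def twist (c : TRing k) (hc : TRing.D k c = c ^ 2) : ModC (T k) :=
  letI o : IndObj k (TRing k) :=
    { D := (TRing.D k + LinearMap.mulRight k c : TRing k →ₗ[k] TRing k)
      D_D := fun x => by
        change TRing.D k (TRing.D k x + x * c) + (TRing.D k x + x * c) * c = 0
        rw [map_add, TRing.D_D, TRing.D_mul, hc]
        have h := Ver4.add_self k (TRing.D k x * c + x * c ^ 2)
        linear_combination h }
  { carrier := TRing k
    addCommGroup := inferInstanceAs (AddCommGroup (TRing k))
    moduleBase := inferInstanceAs (Module k (TRing k))
    module := inferInstanceAs (Module (TRing k) (TRing k))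
    tower := inferInstanceAs (IsScalarTower k (TRing k) (TRing k))
    obj := o
    isMod :=
      letI m : Module (T k) (TRing k) := inferInstanceAs (Module (TRing k) (TRing k))
      { D_smul := fun (a x : TRing k) => by
          change TRing.D k (a * x) + a * x * c = TRing.D k a * x + a * (TRing.D k x + x * c)
          rw [TRing.D_mul]
          ring } }

section twist
variable (c : TRing k) (hc : TRing.D k c = c ^ 2)

/-- The generator `1`. -/
def twistGen : twist k c hc := (1 : TRing k)

theorem twist_eq (x : twist k c hc) : ∃ a : T k, x = a • twistGen k c hc :=
  ⟨x, (mul_one (show TRing k from x)).symm⟩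

theorem D_twistGen : D k (twistGen k c hc) = T.of k c • twistGen k c hc := by
  change TRing.D k 1 + 1 * c = c * 1
  have h : TRing.D k 1 = 0 := D_one (A := TRing k) k
  rw [h]
  ring

end twist

/-- The module `L_u`: the regular module with `D 1 = t` (hence `D t² = t³`). -/
def Lu : ModC (T k) := twist k (TRing.t k) (TRing.D_t k)

/-- The generator `1` of `L_u`. -/
def u : Lu k := twistGen k _ _

theorem D_u : D k (u k) = T.of k (TRing.t k) • u k := D_twistGen k _ _

theorem D_sq_u : D k (T.of k (TRing.t k ^ 2) • u k) =
    T.of k (TRing.t k ^ 3) • u k := by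
  have h : D k (T.of k (TRing.t k ^ 2)) = 0 := by
    change TRing.D k (TRing.t k ^ 2) = 0
    rw [← TRing.D_t, TRing.D_D]
  rw [IsMod.D_smul (k := k), h, zero_smul, zero_add, D_u, ← mul_smul]
  congr 1

theorem D_inv_gen : TRing.D k (TRing.t k + TRing.t k ^ 3) = (TRing.t k + TRing.t k ^ 3) ^ 2 := by
  have h4 := TRing.t_pow_four k
  have hD : TRing.D k (TRing.t k ^ 2) = 0 := by rw [← TRing.D_t, TRing.D_D]
  have h3 : TRing.D k (TRing.t k ^ 3) = 0 := by
    rw [pow_succ, TRing.D_mul, hD, TRing.D_t]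
    linear_combination h4
  rw [map_add, h3, TRing.D_t]
  linear_combination (-(2 + TRing.t k ^ 2)) * h4

theorem inv_gen_aux : TRing.t k + ((TRing.t k + TRing.t k ^ 3) +
    TRing.D k (TRing.t k + TRing.t k ^ 3) * TRing.t k) = 0 := by
  rw [D_inv_gen]
  linear_combination TRing.add_self k (TRing.t k + TRing.t k ^ 3) +
    (2 * TRing.t k + TRing.t k ^ 3) * TRing.t_pow_four k

/-- The inverse of `L_u`. -/
def LuInv : ModC (T k) := twist k (TRing.t k + TRing.t k ^ 3) (D_inv_gen k)

def luPair : tensor (Lu k) (LuInv k) →ₗ[T k] T k :=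
  tLift (Lu k) (LuInv k) (W := T k)
    (LinearMap.mk₂' (T k) k
      (fun (x : Lu k) (y : LuInv k) => (show T k from
        (show TRing k from x) * ((show TRing k from y) + TRing.D k y * TRing.t k)))
      (fun x x' y => add_mul (R := TRing k) _ _ _)
      (fun a x y => mul_assoc (G := TRing k) _ _ _)
      (fun x y y' => by
        change TRing k at x y y'
        change x * (y + y' + TRing.D k (y + y') * TRing.t k) =
          x * (y + TRing.D k y * TRing.t k) + x * (y' + TRing.D k y' * TRing.t k)
        rw [map_add]
        ring)
      (fun r x y => by
        change TRing k at x y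
        change x * (r • y + TRing.D k (r • y) * TRing.t k) =
          r • (x * (y + TRing.D k y * TRing.t k))
        rw [map_smul, smul_mul_assoc, ← smul_add, mul_smul_comm]))
    (fun a x y => by
      change TRing k at a x y
      change x * (a * y + TRing.D k (a * y) * TRing.t k) =
        (a * x + TRing.D k a * (TRing.D k x + x * TRing.t k)) * (y + TRing.D k y * TRing.t k)
      rw [TRing.D_mul]
      have h1 := TRing.D_mul_D k a x
      have h2 := TRing.D_mul_D k a y
      linear_combination (-(y + TRing.D k y * TRing.t k)) * h1 - x * TRing.t k ^ 2 * h2)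

theorem Lu_invertible : Invertible (Lu k) := by
  let v : LuInv k := twistGen k _ _
  refine ⟨LuInv k, Iso.nonempty_of_bijective
    { LinearMap.toSpanSingleton (T k) (tensor (Lu k) (LuInv k)) (tMk _ _ (u k) v) with
      map_D := fun b => ?_ } ⟨?_, ?_⟩⟩
  · change T k at b
    change D k b • tMk _ _ (u k) v = D k (b • tMk _ _ (u k) v)
    have hv : D k v = T.of k (TRing.t k + TRing.t k ^ 3) • v := D_twistGen k _ _
    have h : D k (tMk _ _ (u k) v) = 0 := by
      rw [D_tMk, D_u, hv, tMk_smul, D_u, ← mul_smul, ← add_smul, ← smul_tMk, ← smul_tMk,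
        ← add_smul]
      have h0 : T.of k (TRing.t k) + (T.of k (TRing.t k + TRing.t k ^ 3) +
          D k (T.of k (TRing.t k + TRing.t k ^ 3)) * T.of k (TRing.t k)) = 0 := inv_gen_aux k
      exact (congrArg (· • tMk _ _ (u k) v) h0).trans (zero_smul _ _)
    rw [IsMod.D_smul (k := k), h, smul_zero, add_zero]
  · intro b c hbc
    change T k at b c
    have hbc : b • tMk _ _ (u k) v = c • tMk _ _ (u k) v := hbc
    have h := congrArg (luPair k) hbc
    have h1 : luPair k (tMk _ _ (u k) v) = 1 := by
      change (1 : TRing k) * ((1 : TRing k) + TRing.D k 1 * TRing.t k) = 1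
      have h : TRing.D k 1 = 0 := D_one (A := TRing k) k
      rw [h]
      ring
    rw [map_smul, map_smul, h1] at h
    exact (mul_one b).symm.trans (h.trans (mul_one c))
  · intro x
    suffices h : x ∈ LinearMap.range (LinearMap.toSpanSingleton (T k) _ (tMk _ _ (u k) v)) from h
    induction x using t_induction with
    | hadd x y hx hy => exact add_mem hx hy
    | h x y =>
      obtain ⟨a, rfl⟩ := twist_eq k _ _ x
      obtain ⟨b, rfl⟩ := twist_eq k _ _ y
      change tMk (Lu k) (LuInv k) (a • u k) (b • v) ∈ _
      rw [← smul_tMk, tMk_smul, D_u, ← mul_smul, ← add_smul, ← smul_tMk]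
      exact Submodule.smul_mem _ _ ⟨_, rfl⟩

/-- The morphism `P → L_u` with `v₁ ↦ 1`. -/
def PtoLu : P k →ₗ[k] Lu k :=
  LinearMap.coprod (LinearMap.toSpanSingleton k (Lu k) (u k))
    (LinearMap.toSpanSingleton k (Lu k) (D k (u k)))

theorem PtoLu_D (v : P k) : PtoLu k (D k v) = D k (PtoLu k v) := by
  change (0 : k) • u k + v.1 • D k (u k) = D k (v.1 • u k + v.2 • D k (u k))
  rw [zero_smul, zero_add, map_add, map_smul, map_smul, D_D, smul_zero, add_zero]

variable (θ : ObjIso k (P k) (Module.Dual k (P k)))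

/-- The epimorphism `T ⊗ P^* ≅ T ⊗ P ↠ L_u`, `1 ⊗ v₁ ↦ 1`, for an isomorphism `θ : P ≅ P^*`. -/
def basePoint : ProjPoint (T k) (P k) where
  L := Lu k
  invertible := Lu_invertible k
  p := freeLift (Lu k) (PtoLu k ∘ₗ θ.toLinearEquiv.symm.toLinearMap) (fun w => by
    change PtoLu k (θ.toLinearEquiv.symm (D k w)) = D k (PtoLu k (θ.toLinearEquiv.symm w))
    rw [ObjIso.symm_D k _ _ θ, PtoLu_D])
  surjective := fun x => by
    obtain ⟨a, rfl⟩ := twist_eq k _ _ x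
    refine ⟨a ⊗ₜ θ.toLinearEquiv (P.v₁ k), ?_⟩
    change a • PtoLu k (θ.toLinearEquiv.symm (θ.toLinearEquiv (P.v₁ k))) = _
    rw [LinearEquiv.symm_apply_apply]
    change a • ((1 : k) • u k + (0 : k) • D k (u k)) = a • u k
    rw [one_smul, zero_smul, add_zero]

/-- The corresponding element of the projective space of `P` at `T`. -/
def basePointClass : (projSpace k (P k)).obj (T k) := Quotient.mk _ (basePoint k θ)

/-- The corresponding natural transformation, by the Yoneda lemma. -/
def toProj : Phi (T k) ⟶ projSpace k (P k) :=
  uliftCoyonedaEquiv.{u + 1}.symm (basePointClass k θ)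

end T

end Ver4

end

noncomputable section

namespace Ver4

namespace ModC
variable {k : Type u} [Field k] [CharP k 2] {A : AlgC k}

/-! A point of the projective space over `A` is an invertible module `L` generated by the image `x`
of `v₁` together with `D x`, the image of `v₂`. The crux is that such an `L` is already free on `x`
(`Invertible.free_of_generated`). Commutativity of `A` forces `(D a)² = 0`, so the contribution of
`D x` is nilpotent and can be removed.

Freeness gives a unique `a` with `D x = a x`, and `D² x = 0` then says exactly `D a = a²`. The
scalar `a` is a complete invariant of the point (`rel_of_D_gen`, `D_gen_of_rel`), is carried to `φ
a` by base change along `φ`, and equals `t` for the given element over `T`. On the other side, `D a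
= a²` implies `a⁴ = (D a)² = 0`, so such elements `a` are the same as morphisms `T ⟶ A`. Hence the
given element is universal (`basePointClass_bijective`).

For the sheaf property it is enough to treat the functor of points of `T`, since the condition
passes along isomorphisms of functors. Morphisms out of `T` are elements satisfying an equation, so
they descend once elements do (`FaithfullyFlat.exists_of_family`). This is the usual argument that
`A` is the equalizer of `B ⇉ B ⊗_A B`; it needs `B ⊗_A C` as an algebra, whose multiplication is
twisted by the braiding (`BraidedTensor.pushout`). -/

theorem D_mul_D_self (a : A) : D k a * D k a = 0 := by
  simpa using mul_comm' k a a

/-- The braiding correction can be moved to the other side because values of `D` are central and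
every element is its own negative. In this form the rule serves to put products in a chosen order.
-/
theorem mul_eq_add (a b : A) : b * a = a * b + D k a * D k b := by
  rw [← mul_comm' k a b, D_mul_comm a (D k b), add_assoc, Ver4.add_self k, add_zero]

/-! ### Invertible modules generated by `x` and `D x` -/

section generator
variable {L N : ModC A} (e : Iso (tensor L N) (self A))

theorem D_pairing (l : L) (n : N) :
    D k (pairing e l n) = pairing e (D k l) n + pairing e l (D k n) := by
  refine (e.map_D (tMk L N l n)).symm.trans ?_
  rw [D_tMk]
  exact map_add e.toLinearEquiv _ _

theorem pairing_zero (l : L) : pairing e l 0 = 0 := by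
  simpa using pairing_add e l 0 0

/-- A module generated by `x` and `D x` and invertible has a functional that is `1` at `x`. -/
theorem exists_pairing_eq_one (x : L) (hx : ∀ l : L, ∃ a b : A, l = a • x + b • D k x) :
    ∃ n : N, pairing e x n = 1 := by
  have hD : ∀ (a : A) (n : N), pairing e (D k x) (a • n) = a * pairing e (D k x) n :=
    fun a n => by rw [pairing_smul, D_D, zero_pairing, mul_zero, add_zero]
  have key : ∀ t : tensor L N, ∃ n n' : N,
      (show A from e.toLinearEquiv t) = pairing e x n + pairing e (D k x) n' := by
    intro t
    induction t using t_induction with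
    | h l n =>
      obtain ⟨a, b, rfl⟩ := hx l
      -- Moving `a` across the pairing turns `a ⟨x, n⟩` into `⟨x, a n⟩` plus `D a ⟨D x, n⟩`; the
      -- summand `D a • n` of the second vector cancels this correction.
      refine ⟨a • n, b • n + D k a • n, ?_⟩
      change pairing e (a • x + b • D k x) n = _
      rw [add_pairing, smul_pairing, smul_pairing, pairing_smul, pairing_add, hD, hD]
      rw [add_assoc, add_left_comm (D k a * _), Ver4.add_self k (D k a * _), add_zero]
    | hadd s t hs ht =>
      obtain ⟨n, n', h⟩ := hs
      obtain ⟨m, m', h'⟩ := ht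
      refine ⟨n + m, n' + m', ?_⟩
      rw [pairing_add, pairing_add]
      refine (map_add e.toLinearEquiv s t).trans ?_
      refine (congrArg₂ (fun x y : A => x + y) h h').trans ?_
      abel
  obtain ⟨n, n', h⟩ := key (e.toLinearEquiv.symm (1 : A))
  rw [LinearEquiv.apply_symm_apply] at h
  have h : (1 : A) = pairing e x n + pairing e (D k x) n' := h
  -- The Leibniz rule for `⟨x, n'⟩` trades `⟨D x, n'⟩` for `⟨x, D n'⟩`, at the cost of a value of
  -- `D`.
  have h2 : pairing e x (n + D k n') = 1 + D k (pairing e x n') := by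
    rw [D_pairing, h, pairing_add]
    rw [add_assoc, ← add_assoc (pairing e (D k x) n'), Ver4.add_self k (pairing e (D k x) n'),
      zero_add]
  -- The scalar `1 + D c` is its own inverse since `(D c)² = 0`, and it is killed by `D`, so it
  -- leaves the pairing without a correction term.
  refine ⟨(1 + D k (pairing e x n')) • (n + D k n'), ?_⟩
  rw [pairing_smul, map_add, D_one, D_D, add_zero, zero_mul, add_zero, h2, mul_add, add_mul,
    add_mul, D_mul_D_self, mul_one, mul_one, one_mul, add_zero, add_assoc, Ver4.add_self k, add_zero]

/-- The map `m ⊗ n ↦ e(x, n) m + e(x, D n) D m`, obtained from the pairing of `x` with `n` by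
moving `m` across. -/
def contract (x : L) : L ⊗[k] N →ₗ[k] L :=
  TensorProduct.lift (LinearMap.mk₂ k
    (fun (m : L) (n : N) => pairing e x n • m + pairing e x (D k n) • D k m)
    (fun m m' n => by simp only [map_add, smul_add]; abel)
    (fun c m n => by simp only [map_smul, smul_add, smul_comm c])
    (fun m n n' => by simp only [map_add, pairing_add, add_smul]; abel)
    (fun c m n => by simp only [map_smul, pairing_smul', smul_assoc, smul_add]))

theorem contract_tmul (x m : L) (n : N) :
    contract e x (m ⊗ₜ[k] n) = pairing e x n • m + pairing e x (D k n) • D k m := rfl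

/-- The scalar `a` has to pass the pairing with `x`, and the braiding then differentiates both. The
contraction is thus not linear for a fixed `x`, only for `x` and `D x` taken together. -/
theorem contract_smul (x : L) (a : A) (t : L ⊗[k] N) :
    contract e x (a • t) = a • contract e x t + D k a • contract e (D k x) t := by
  induction t with
  | zero => simp
  | add s t hs ht => simp only [smul_add, map_add, hs, ht]; abel
  | tmul m n =>
    have h1 := mul_eq_add a (pairing e x n)
    have h2 := mul_eq_add a (pairing e x (D k n))
    have h3 := D_mul_comm (k := k) a (pairing e x (D k n))
    rw [TensorProduct.smul_tmul']
    simp only [contract_tmul, IsMod.D_smul (k := k), smul_add, ← mul_smul, h1, h2, ← h3, add_smul,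
      D_pairing, D_D, pairing_zero, mul_zero, zero_smul, mul_add]
    abel_nf
    simp only [two_smul, Ver4.add_self k, zero_add]

/-- This lets the contraction be evaluated on classes in `L ⊗_A N`: an element of `L ⊗ N` that dies
there contracts to zero. -/
theorem contract_rel (x : L) (t : L ⊗[k] N) (ht : t ∈ tensorRel L N) : contract e x t = 0 := by
  -- The claim is proved for all `x` at once because the scalar step calls on it for `D x` too.
  have : ∀ x : L, contract e x t = 0 := by
    rw [tensorRel] at ht
    induction ht using Submodule.span_induction with
    | mem t ht =>
      obtain ⟨m, a, n, rfl⟩ := ht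
      intro x
      simp only [map_sub, contract_tmul, pairing_smul, map_add, IsMod.D_smul (k := k), D_D,
        smul_zero, add_zero, smul_add, pairing_add, add_smul, ← mul_smul]
      have h1 := mul_eq_add a (pairing e x n)
      have h2 := mul_eq_add a (pairing e x (D k n))
      have h3 := D_mul_comm (k := k) a (pairing e x (D k n))
      have h4 := D_mul_comm (k := k) a (pairing e x n)
      simp only [h1, h2, ← h3, ← h4, D_pairing, mul_add, add_smul, D_D,
        pairing_zero, mul_zero, zero_mul, zero_smul]
      abel_nf
      simp only [two_smul, Ver4.add_self k]
    | zero => simp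
    | add s t _ _ hs ht => intro x; rw [map_add, hs, ht, add_zero]
    | smul a t _ ht => intro x; rw [contract_smul, ht, ht, smul_zero, smul_zero, add_zero]
  exact this x

/-- The difference `y` of the two sides pairs to zero with `n`, so `y ⊗ n` vanishes in `L ⊗_A N` as
`e` is injective. Contracting with `x` gives `y = c • D y` for `c = ⟨x, D n⟩`. Applying `D` yields
`D y = D c • D y`, which iterates to `D y = (D c)² • D y = 0`, and so `y = 0`. -/
theorem eq_smul_of_pairing_eq_one {x : L} {n : N} (hn : pairing e x n = 1) (l : L) :
    l = pairing e l n • x := by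
  set y := l - pairing e l n • x with hy
  have h0 : pairing e y n = 0 := by
    have h := add_pairing e y (pairing e l n • x) n
    rw [hy, sub_add_cancel, smul_pairing, hn, mul_one] at h
    exact right_eq_add.1 h
  have h1 : tMk L N y n = 0 := e.toLinearEquiv.map_eq_zero_iff.1 h0
  have h2 := contract_rel e x (y ⊗ₜ[k] n) ((Submodule.Quotient.mk_eq_zero _).1 h1)
  rw [contract_tmul, hn, one_smul] at h2
  have h3 : y = pairing e x (D k n) • D k y := by
    exact (eq_neg_of_add_eq_zero_left h2).trans
      (eq_neg_of_add_eq_zero_left (Ver4.add_self k _)).symm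
  have h4 : D k y = D k (pairing e x (D k n)) • D k y := by
    conv_lhs => rw [h3, IsMod.D_smul (k := k), D_D, smul_zero, add_zero]
  have h5 : D k y = 0 := by
    rw [h4, h4, ← mul_smul, D_mul_D_self, zero_smul]
  rw [h5, smul_zero] at h3
  exact sub_eq_zero.1 (hy.symm.trans h3)

end generator

/-- An invertible module generated by `x` and `D x` is free on `x`. -/
theorem Invertible.free_of_generated {L : ModC A} (h : Invertible L) (x : L)
    (hx : ∀ l : L, ∃ a b : A, l = a • x + b • D k x) :
    Function.Bijective (fun a : A => a • x) := by
  obtain ⟨N, ⟨e⟩⟩ := h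
  obtain ⟨n, hn⟩ := exists_pairing_eq_one e x hx
  refine ⟨fun a b hab => ?_, fun l => ⟨_, (eq_smul_of_pairing_eq_one e hn l).symm⟩⟩
  have h := congrArg (fun l => pairing e l n) hab
  simpa only [smul_pairing, hn, mul_one] using h

end ModC

open ModC

variable {k : Type u} [Field k] [CharP k 2] {A B C : AlgC k}

/-! ### Morphisms out of `T` -/

section homT
open Polynomial

/-- By linearity this is a statement about powers of `a`, where the Leibniz rule behaves as in a
commutative ring because powers of `a` commute with each other. -/
theorem D_aeval (a : A) (h : D k a = a ^ 2) (p : k[X]) :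
    D k (aeval a p) = aeval a (X ^ 2 * derivative p) := by
  induction p using Polynomial.induction_on' with
  | add p q hp hq => simp only [map_add, mul_add, hp, hq]
  | monomial n c =>
    have key : ∀ n : ℕ, D k (a ^ n) = aeval a (X ^ 2 * derivative (X ^ n : k[X])) := by
      intro n
      induction n with
      | zero => simp
      | succ n ih =>
        rw [pow_succ, D_mul, ih, h, pow_succ (X : k[X]) n, derivative_mul, derivative_X]
        simp only [map_mul, map_add, map_pow, aeval_X, mul_one, mul_add, mul_assoc]
        rw [← pow_add, ← pow_add, add_comm n]
    rw [← C_mul_X_pow_eq_monomial, derivative_C_mul, mul_left_comm, C_mul', C_mul', map_smul,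
      map_smul, map_smul, ← key, map_pow, aeval_X]

/-- Here `a⁴` is the square of `D a`. The relation `t⁴ = 0` in `T` is therefore forced by `D t =
t²`. -/
theorem pow_four_eq_zero (a : A) (h : D k a = a ^ 2) : a ^ 4 = 0 := by
  have := D_mul_D_self (k := k) a
  rwa [h, ← pow_add] at this

/-- The morphism `T ⟶ A` with `t ↦ a`. -/
def T.lift (a : A) (h : D k a = a ^ 2) : T k ⟶ A where
  toAlgHom := (Ideal.Quotient.liftₐ (Ideal.span {(X : k[X]) ^ 4}) (aeval a) (by
    intro p hp
    obtain ⟨q, rfl⟩ := Ideal.mem_span_singleton.1 hp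
    rw [map_mul, map_pow, aeval_X, pow_four_eq_zero a h, zero_mul]) : TRing k →ₐ[k] A)
  map_D x := by
    obtain ⟨p, rfl⟩ := TRing.mk_surjective k x
    refine Eq.trans ?_ (D_aeval a h p).symm
    exact congrArg (Ideal.Quotient.liftₐ (Ideal.span {(X : k[X]) ^ 4}) (aeval a) _)
      (TRing.D_mk k p)

theorem T.lift_t (a : A) (h : D k a = a ^ 2) : T.lift a h (T.of k (TRing.t k)) = a :=
  aeval_X (R := k) a

theorem T.hom_ext {φ ψ : T k ⟶ A}
    (h : φ (T.of k (TRing.t k)) = ψ (T.of k (TRing.t k))) : φ = ψ := by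
  have : φ.toAlgHom.comp (TRing.mk k) = ψ.toAlgHom.comp (TRing.mk k) := Polynomial.algHom_ext h
  refine DFunLike.ext _ _ fun x => ?_
  obtain ⟨p, rfl⟩ := TRing.mk_surjective k x
  exact AlgHom.congr_fun this p

theorem T.D_map_t (φ : T k ⟶ A) :
    D k (φ (T.of k (TRing.t k))) = φ (T.of k (TRing.t k)) ^ 2 := by
  rw [← AlgC.map_D, ← map_pow]
  exact congrArg φ (TRing.D_t k)

end homT

/-! ### Points of the projective space of `P` -/

section points
variable (θ : ObjIso k (P k) (Module.Dual k (P k)))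

theorem P.eq_smul_add {k : Type u} [Field k] (v : P k) : v = v.1 • P.v₁ k + v.2 • D k (P.v₁ k) := by
  change (v.1, v.2) = ((v.1 * 1 + v.2 * 0 : k), (v.1 * 0 + v.2 * 1 : k))
  simp

namespace ProjPoint

/-- The image of `v₁`, through the isomorphism `P ≅ P^*`. -/
def gen (x : ProjPoint A (P k)) : x.L := freeRes x.p (θ.toLinearEquiv (P.v₁ k))

/-- Since `v₂ = D v₁` and the map commutes with `D`, the image of `v₁` determines everything. -/
theorem exists_freeRes_eq (x : ProjPoint A (P k)) (w : Module.Dual k (P k)) :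
    freeRes x.p w = (θ.toLinearEquiv.symm w).1 • gen θ x +
      (θ.toLinearEquiv.symm w).2 • D k (gen θ x) := by
  obtain ⟨v, rfl⟩ := θ.toLinearEquiv.surjective w
  have h : D k (θ.toLinearEquiv (P.v₁ k)) = θ.toLinearEquiv (D k (P.v₁ k)) :=
    (θ.map_D (P.v₁ k)).symm
  rw [LinearEquiv.symm_apply_apply, gen, ← freeRes_D, h, ← map_smul, ← map_smul, ← map_smul,
    ← map_smul, ← map_add, ← map_add, ← P.eq_smul_add]

theorem generated (x : ProjPoint A (P k)) (l : x.L) :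
    ∃ a b : A, l = a • gen θ x + b • D k (gen θ x) := by
  obtain ⟨t, rfl⟩ := x.surjective l
  change A ⊗[k] Module.Dual k (P k) at t
  induction t with
  | zero => exact ⟨0, 0, by rw [map_zero, zero_smul, zero_smul, add_zero]⟩
  | add s t hs ht =>
    obtain ⟨a, b, h⟩ := hs
    obtain ⟨a', b', h'⟩ := ht
    refine ⟨a + a', b + b', ?_⟩
    rw [map_add, h, h', add_smul, add_smul]
    abel
  | tmul a w =>
    refine ⟨(θ.toLinearEquiv.symm w).1 • a, (θ.toLinearEquiv.symm w).2 • a, ?_⟩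
    rw [apply_tmul, exists_freeRes_eq θ, smul_add, smul_assoc, smul_assoc, smul_comm a,
      smul_comm a]

theorem gen_bijective (x : ProjPoint A (P k)) :
    Function.Bijective (fun a : A => a • gen θ x) :=
  x.invertible.free_of_generated _ (generated θ x)

/-- With `x` the generator, applying `D` to `a x = D x` gives `(D a + a²) x = 0`, and freeness turns
this into an equation in `A`. -/
theorem exists_D_gen (x : ProjPoint A (P k)) :
    ∃ a : A, D k a = a ^ 2 ∧ D k (gen θ x) = a • gen θ x := by
  obtain ⟨a, ha⟩ := (gen_bijective θ x).2 (D k (gen θ x))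
  refine ⟨a, ?_, ha.symm⟩
  have h : (D k a + a ^ 2) • gen θ x = (0 : A) • gen θ x := by
    have h := congrArg (D k) ha
    simp only [IsMod.D_smul (k := k), D_D] at h
    rw [← ha] at h
    rw [add_smul, pow_two, mul_smul, zero_smul]
    exact h
  have h := (gen_bijective θ x).1 h
  rw [eq_neg_of_add_eq_zero_left h]
  exact (eq_neg_of_add_eq_zero_left (Ver4.add_self k _)).symm

/-- Both modules are free on their generators, so there are mutually inverse linear maps exchanging
these. They respect the projections because the image of `v₂` is the same multiple `a` of the
generator on both sides. -/
theorem rel_of_D_gen {x y : ProjPoint A (P k)} {a : A} (hx : D k (gen θ x) = a • gen θ x)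
    (hy : D k (gen θ y) = a • gen θ y) : Rel x y := by
  have key : ∀ x y : ProjPoint A (P k), D k (gen θ x) = a • gen θ x →
      D k (gen θ y) = a • gen θ y →
      ∃ f : x.L →ₗ[A] y.L, ∀ v, f (freeRes x.p v) = freeRes y.p v := by
    intro x y hx hy
    let E : A ≃ₗ[A] x.L :=
      LinearEquiv.ofBijective (LinearMap.toSpanSingleton A x.L (gen θ x)) (gen_bijective θ x)
    let f : x.L →ₗ[A] y.L :=
      LinearMap.toSpanSingleton A y.L (gen θ y) ∘ₗ E.symm.toLinearMap
    have hf : ∀ b : A, f (b • gen θ x) = b • gen θ y := fun b => by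
      have : E.symm (b • gen θ x) = b := E.symm_apply_apply b
      change E.symm (b • gen θ x) • gen θ y = _
      rw [this]
    refine ⟨f, fun v => ?_⟩
    rw [exists_freeRes_eq θ, exists_freeRes_eq θ, hx, hy, ← smul_assoc, ← smul_assoc,
      ← algebraMap_smul A, ← algebraMap_smul A (_ : k) (gen θ y), map_add, hf, hf]
  obtain ⟨f, hf⟩ := key x y hx hy
  obtain ⟨g, hg⟩ := key y x hy hx
  exact rel_of f g hf hg

/-- An equivalence carries generator to generator and commutes with `D`; the scalar is thus an
invariant of the class of the point. -/
theorem D_gen_of_rel {x y : ProjPoint A (P k)} {a : A} (hx : D k (gen θ x) = a • gen θ x)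
    (h : Rel x y) : D k (gen θ y) = a • gen θ y := by
  obtain ⟨e, he⟩ := h
  have h1 : e.toLinearEquiv (gen θ x) = gen θ y := he _
  rw [← h1, ← map_smul, ← hx]
  exact (e.map_D _).symm

theorem D_gen_baseChange (φ : A ⟶ B) {x : ProjPoint A (P k)} {a : A}
    (hx : D k (gen θ x) = a • gen θ x) :
    D k (gen θ (x.baseChange φ)) = φ a • gen θ (x.baseChange φ) := by
  have h : gen θ (x.baseChange φ) = bcInl φ x.L (gen θ x) := freeRes_baseChange φ x _
  rw [h]
  exact (bcInl_D φ (gen θ x)).symm.trans ((congrArg _ hx).trans (bcInl_smul φ x.L a (gen θ x)))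

end ProjPoint

open ProjPoint

theorem D_gen_basePoint :
    D k (gen θ (basePoint k θ)) = T.of k (TRing.t k) • gen θ (basePoint k θ) := by
  have h : gen θ (basePoint k θ) = u k := by
    refine (one_smul (T k) _).trans ?_
    change PtoLu k (θ.toLinearEquiv.symm (θ.toLinearEquiv (P.v₁ k))) = _
    rw [LinearEquiv.symm_apply_apply]
    change (1 : k) • u k + (0 : k) • D k (u k) = u k
    rw [one_smul, zero_smul, add_zero]
  rw [h]
  exact D_u k

/-- The class of the base point is universal. -/
theorem basePointClass_bijective (A : AlgC k) :
    Function.Bijective (fun φ : T k ⟶ A => (projSpace k (P k)).map φ (basePointClass k θ)) := by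
  constructor
  · intro φ ψ h
    have h : Rel ((basePoint k θ).baseChange φ) ((basePoint k θ).baseChange ψ) := Quotient.exact h
    have h1 := D_gen_of_rel θ (D_gen_baseChange θ φ (D_gen_basePoint θ)) h
    have h2 := D_gen_baseChange θ ψ (D_gen_basePoint θ)
    -- On the second base change `D` multiplies the generator by both `φ t` and `ψ t`, so these
    -- agree by freeness.
    exact T.hom_ext ((gen_bijective θ _).1 (h1.symm.trans h2))
  · intro x
    obtain ⟨x, rfl⟩ := Quotient.exists_rep x
    obtain ⟨a, ha, hx⟩ := exists_D_gen θ x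
    refine ⟨T.lift a ha, Quotient.sound ?_⟩
    have h := D_gen_baseChange θ (T.lift a ha) (D_gen_basePoint θ)
    rw [T.lift_t] at h
    exact rel_of_D_gen θ h hx

/-- The representation of the projective space by `T`. -/
def corepresentableBy : (projSpace k (P k)).CorepresentableBy (T k) where
  homEquiv := Equiv.ofBijective _ (basePointClass_bijective θ _)
  homEquiv_comp g f := by
    simp only [Equiv.ofBijective_apply, Functor.map_comp]
    rfl

/-- Each component is, up to the universe lift in `Phi`, pullback of the universal class. -/
instance isIso_toProj : IsIso (toProj k θ) := by
  refine (NatTrans.isIso_iff_isIso_app _).2 fun A => ?_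
  rw [isIso_iff_bijective]
  exact (basePointClass_bijective θ A).comp Equiv.ulift.bijective

/-- Through this the projective space inherits the sheaf condition from `T`, and no descent of
invertible modules is needed. -/
theorem isFaisceau_of_iso {F G : AlgC k ⥤ Type (u + 1)} (i : F ≅ G) (hF : IsFaisceau F) :
    IsFaisceau G := by
  intro ι _ A B φ hφ x hx
  have nat : ∀ {A B : AlgC k} (f : A ⟶ B) (z : G.obj A),
      F.map f (i.inv.app A z) = i.inv.app B (G.map f z) := fun f z =>
    (ConcreteCategory.congr_hom (i.inv.naturality f) z).symm
  have nat' : ∀ {A B : AlgC k} (f : A ⟶ B) (z : F.obj A),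
      G.map f (i.hom.app A z) = i.hom.app B (F.map f z) := fun f z =>
    (ConcreteCategory.congr_hom (i.hom.naturality f) z).symm
  have hi : ∀ (A : AlgC k) (z : F.obj A), i.inv.app A (i.hom.app A z) = z := fun A z =>
    ConcreteCategory.congr_hom (i.hom_inv_id_app A) z
  have hi' : ∀ (A : AlgC k) (z : G.obj A), i.hom.app A (i.inv.app A z) = z := fun A z =>
    ConcreteCategory.congr_hom (i.inv_hom_id_app A) z
  obtain ⟨y, hy, hu⟩ := hF ι A B φ hφ (fun j => i.inv.app _ (x j)) (fun j l C f g h => by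
    rw [nat, nat, hx j l C f g h])
  refine ⟨i.hom.app A y, fun j => ?_, fun z hz => ?_⟩
  · rw [nat', hy, hi']
  · rw [← hu (i.inv.app A z) (fun j => ?_), hi']
    rw [nat, hz]

end points

/-! ### The pushout of algebras `B ⊗_A C` -/

/-- The tensor product of two algebras, with the multiplication twisted by the braiding. -/
def BraidedTensor (B C : AlgC k) : Type u := B ⊗[k] C

namespace BraidedTensor

instance : AddCommGroup (BraidedTensor B C) := inferInstanceAs (AddCommGroup (B ⊗[k] C))
instance : Module k (BraidedTensor B C) := inferInstanceAs (Module k (B ⊗[k] C))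

/-- The element `b ⊗ c`. -/
def tmul (b : B) (c : C) : BraidedTensor B C := b ⊗ₜ[k] c

/-- The multiplication as a bilinear map on the tensor product. -/
def mulAux : B ⊗[k] C →ₗ[k] B ⊗[k] C →ₗ[k] B ⊗[k] C :=
  TensorProduct.lift (LinearMap.mk₂ k
    (fun (b : B) (c : C) =>
      TensorProduct.map (LinearMap.mulLeft k b) (LinearMap.mulLeft k c) +
        TensorProduct.map (LinearMap.mulLeft k b ∘ₗ D k) (LinearMap.mulLeft k (D k c)))
    (fun b b' c => TensorProduct.ext' fun x y => by
      simp only [LinearMap.add_apply, TensorProduct.map_tmul, LinearMap.mulLeft_apply,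
        LinearMap.comp_apply, add_mul, TensorProduct.add_tmul]
      abel)
    (fun r b c => TensorProduct.ext' fun x y => by
      simp only [LinearMap.add_apply, LinearMap.smul_apply, TensorProduct.map_tmul,
        LinearMap.mulLeft_apply, LinearMap.comp_apply, smul_mul_assoc, TensorProduct.smul_tmul',
        smul_add])
    (fun b c c' => TensorProduct.ext' fun x y => by
      simp only [LinearMap.add_apply, TensorProduct.map_tmul, LinearMap.mulLeft_apply,
        LinearMap.comp_apply, map_add, add_mul, TensorProduct.tmul_add]
      abel)
    (fun r b c => TensorProduct.ext' fun x y => by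
      simp only [LinearMap.add_apply, LinearMap.smul_apply, TensorProduct.map_tmul,
        LinearMap.mulLeft_apply, LinearMap.comp_apply, map_smul, smul_mul_assoc,
        TensorProduct.tmul_smul, smul_add]))

/-- The multiplication `(b ⊗ c) (b' ⊗ c') = b b' ⊗ c c' + b D(b') ⊗ D(c) c'`. -/
def mulMap : BraidedTensor B C →ₗ[k] BraidedTensor B C →ₗ[k] BraidedTensor B C :=
  mulAux (B := B) (C := C)

theorem induction {p : BraidedTensor B C → Prop} (h : ∀ b c, p (tmul b c))
    (hadd : ∀ x y, p x → p y → p (x + y)) (x : BraidedTensor B C) : p x := by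
  change B ⊗[k] C at x
  induction x with
  | zero =>
    have := h 0 0
    rwa [tmul, TensorProduct.zero_tmul] at this
  | tmul b c => exact h b c
  | add x y hx hy => exact hadd x y hx hy

theorem add_tmul (b b' : B) (c : C) : tmul (b + b') c = tmul b c + tmul b' c :=
  TensorProduct.add_tmul b b' c

theorem tmul_add (b : B) (c c' : C) : tmul b (c + c') = tmul b c + tmul b c' :=
  TensorProduct.tmul_add b c c'

theorem zero_tmul (c : C) : tmul (0 : B) c = 0 := TensorProduct.zero_tmul B c

theorem tmul_zero (b : B) : tmul b (0 : C) = 0 := TensorProduct.tmul_zero C b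

instance : Mul (BraidedTensor B C) := ⟨fun x y => mulMap x y⟩
instance : One (BraidedTensor B C) := ⟨tmul 1 1⟩

theorem one_def : (1 : BraidedTensor B C) = tmul 1 1 := rfl

theorem tmul_mul_tmul (b b' : B) (c c' : C) :
    tmul b c * tmul b' c' = tmul (b * b') (c * c') + tmul (b * D k b') (D k c * c') := rfl

theorem left_distrib' (x y z : BraidedTensor B C) : x * (y + z) = x * y + x * z :=
  map_add (mulMap x) y z

theorem right_distrib' (x y z : BraidedTensor B C) : (x + y) * z = x * z + y * z :=
  LinearMap.map_add₂ mulMap x y z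

instance : Ring (BraidedTensor B C) where
  __ : AddCommGroup (BraidedTensor B C) := inferInstance
  left_distrib := left_distrib'
  right_distrib := right_distrib'
  zero_mul x := LinearMap.map_zero₂ mulMap x
  mul_zero x := map_zero (mulMap x)
  one_mul x := by
    induction x using induction with
    | h b c => simp [one_def, tmul_mul_tmul, tmul_zero]
    | hadd x y hx hy => rw [left_distrib', hx, hy]
  mul_one x := by
    induction x using induction with
    | h b c => simp [one_def, tmul_mul_tmul, zero_tmul]
    | hadd x y hx hy => rw [right_distrib', hx, hy]
  mul_assoc x y z := by
    induction x using induction with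
    | hadd x y hx hy => simp only [right_distrib', hx, hy]
    | h b c =>
    induction y using induction with
    | hadd x y hx hy => simp only [right_distrib', left_distrib', hx, hy]
    | h b' c' =>
    induction z using induction with
    | hadd x y hx hy => simp only [left_distrib', hx, hy]
    | h b'' c'' =>
      simp only [tmul_mul_tmul, left_distrib', right_distrib', D_mul, D_D, mul_zero, zero_mul,
        add_zero, zero_add, mul_add, add_mul, add_tmul, tmul_add, mul_assoc]
      abel

instance : Algebra k (BraidedTensor B C) :=
  Algebra.ofModule (fun r x y => LinearMap.map_smul₂ mulMap r x y)
    (fun r x y => map_smul (mulMap x) r y)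

instance : IndObj k (BraidedTensor B C) := inferInstanceAs (IndObj k (B ⊗[k] C))

theorem D_tmul (b : B) (c : C) : D k (tmul b c) = tmul (D k b) c + tmul b (D k c) := rfl

instance : ComAlg k (BraidedTensor B C) where
  toIndObj := inferInstanceAs (IndObj k (B ⊗[k] C))
  D_mul' := by
    refine TensorProduct.ext' fun x y => ?_
    change D k (x * y) = LinearMap.mul' k _ (D k x ⊗ₜ[k] y + x ⊗ₜ[k] D k y)
    rw [map_add, LinearMap.mul'_apply, LinearMap.mul'_apply]
    induction x using induction with
    | hadd x x' hx hx' => simp only [add_mul, map_add, hx, hx']; abel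
    | h b c =>
    induction y using induction with
    | hadd y y' hy hy' => simp only [mul_add, map_add, hy, hy']; abel
    | h b' c' =>
      simp only [tmul_mul_tmul, mul_add, add_mul, map_add, D_tmul, D_mul, D_D, mul_zero, zero_mul,
        add_zero, zero_add, add_tmul, tmul_add]
      abel_nf
      simp only [Ver4.add_self k, zero_tmul, tmul_zero, add_zero]
  mul_braid := by
    refine TensorProduct.ext' fun x y => ?_
    change LinearMap.mul' k _ (y ⊗ₜ[k] x + D k y ⊗ₜ[k] D k x) = x * y
    rw [map_add, LinearMap.mul'_apply, LinearMap.mul'_apply]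
    induction x using induction with
    | hadd x x' hx hx' => simp only [add_mul, mul_add, map_add, ← hx, ← hx']; abel
    | h b c =>
    induction y using induction with
    | hadd y y' hy hy' => simp only [add_mul, mul_add, map_add, ← hy, ← hy']; abel
    | h b' c' =>
      simp only [tmul_mul_tmul, mul_add, add_mul, D_tmul, D_D, mul_zero, zero_mul, zero_tmul,
        tmul_zero, add_zero]
      -- All products are put in one order, using that values of `D` are central; the terms produced
      -- by the two braidings then cancel in characteristic 2.
      rw [mul_eq_add b b', mul_eq_add c c', ← D_mul_comm (k := k) b b', D_mul_comm (k := k) b' b,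
        D_mul_comm (k := k) b' (D k b), D_mul_comm (k := k) c' c,
        ← D_mul_comm (k := k) c c',
        D_mul_comm (k := k) c' (D k c)]
      simp only [add_tmul, tmul_add]
      have h2 : ∀ z : BraidedTensor B C, (2 : ℤ) • z = 0 := fun z => by rw [two_smul, Ver4.add_self k]
      have h4 : ∀ z : BraidedTensor B C, (4 : ℤ) • z = 0 := fun z => by
        rw [show (4 : ℤ) = 2 * 2 from rfl, mul_smul, h2]
      abel_nf
      simp only [h2, h4, zero_add]

section pushout
variable (φ : A ⟶ B) (ψ : A ⟶ C)

theorem rel_mem (b : B) (a : A) (c : C) :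
    (b * φ a) ⊗ₜ[k] c - b ⊗ₜ[k] (ψ a * c) ∈ bcRel φ (restrict ψ (self C)) :=
  Submodule.subset_span ⟨b, a, c, rfl⟩

/-- The twist is absent because `D 1 = 0`. This compares the module structure that defines `bcRel`
with the ring structure of the braided tensor product. -/
theorem smul_eq_mulMap (b : B) (x : B ⊗[k] C) : b • x = mulMap (tmul b 1) x := by
  induction x with
  | zero => exact (smul_zero b).trans (map_zero (mulMap (tmul b 1))).symm
  | add x y hx hy =>
    exact (smul_add b x y).trans ((congrArg₂ (· + ·) hx hy).trans
      (map_add (mulMap (tmul b 1)) x y).symm)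
  | tmul b' c =>
    change (b * b') ⊗ₜ[k] c = (b * b') ⊗ₜ[k] (1 * c) + (b * D k b') ⊗ₜ[k] (D k 1 * c)
    rw [D_one, zero_mul, TensorProduct.tmul_zero, add_zero, one_mul]

theorem mulMap_mem_bcRel (x : B ⊗[k] restrict ψ (self C))
    (hx : x ∈ bcRel φ (restrict ψ (self C))) (y : BraidedTensor B C) :
    mulMap y x ∈ bcRel φ (restrict ψ (self C)) := by
  suffices h : ∀ y : BraidedTensor B C, mulMap y x ∈ bcRel φ (restrict ψ (self C)) from h y
  rw [bcRel] at hx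
  induction hx using Submodule.span_induction with
  | zero => exact fun y => (congrArg (· ∈ _) (map_zero (mulMap y))).mpr (zero_mem _)
  | add x x' _ _ hx hx' =>
    exact fun y => (congrArg (· ∈ _) (map_add (mulMap y) x x')).mpr (add_mem (hx y) (hx' y))
  | smul b x _ hx =>
    intro y
    -- By associativity the scalar `b` is absorbed into the left factor, which is why `y` has to
    -- vary in the induction.
    refine (congrArg (· ∈ _) ?_).mpr (hx (y * tmul b 1))
    exact (congrArg (y * ·) (smul_eq_mulMap b x)).trans (mul_assoc y (tmul b 1) x).symm
  | mem x hx =>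
    obtain ⟨b, a, c, rfl⟩ := hx
    intro y
    change C at c
    induction y using induction with
    | hadd y y' hy hy' =>
      exact (congrArg (· ∈ _) (LinearMap.map_add₂ mulMap y y' _)).mpr (add_mem hy hy')
    | h b' c' =>
      -- Besides the untwisted and the twisted relation for `a`, one for `D a` is needed: its first
      -- term comes from `D (b * φ a)`, its second from moving `ψ a` to the left past `c'`.
      have h := add_mem (add_mem (rel_mem φ ψ (b' * b) a (c' * c))
        (rel_mem φ ψ (b' * D k b) a (D k c' * c))) (rel_mem φ ψ (b' * b) (D k a) (D k c' * c))
      refine (congrArg (· ∈ _) ?_).mpr h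
      change tmul b' c' * (tmul (b * φ a) c - tmul b (ψ a * c)) =
        (tmul (b' * b * φ a) (c' * c) - tmul (b' * b) (ψ a * (c' * c))) +
        (tmul (b' * D k b * φ a) (D k c' * c) - tmul (b' * D k b) (ψ a * (D k c' * c))) +
        (tmul (b' * b * φ (D k a)) (D k c' * c) - tmul (b' * b) (ψ (D k a) * (D k c' * c)))
      have h1 := mul_eq_add (ψ a) c'
      have h2 := D_mul_comm (k := k) c' (ψ a)
      simp only [mul_sub, tmul_mul_tmul, D_mul, mul_add, AlgC.map_D, ← mul_assoc, h1, h2, add_mul,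
        add_tmul, tmul_add]
      abel

/-- The ideal of `B ⊗ C` defining `B ⊗_A C`. -/
def relIdeal : Ideal (BraidedTensor B C) where
  carrier := {x | x ∈ (bcRel φ (restrict ψ (self C))).carrier}
  add_mem' hx hy := (bcRel φ (restrict ψ (self C))).add_mem hx hy
  zero_mem' := (bcRel φ (restrict ψ (self C))).zero_mem
  smul_mem' y x hx := mulMap_mem_bcRel φ ψ x hx y

theorem D_mem_relIdeal (x : BraidedTensor B C) (hx : x ∈ relIdeal φ ψ) :
    D k x ∈ relIdeal φ ψ :=
  bcRel_stable φ (restrict ψ (self C)) x hx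

/-- Reversing a product costs only a product of derivatives, so a left ideal stable under `D` is
two-sided. -/
instance : (relIdeal φ ψ).IsTwoSided := ⟨fun {x} y hx => by
  rw [← mul_comm' k x y]
  exact add_mem (Ideal.mul_mem_left _ _ hx) (Ideal.mul_mem_left _ _ (D_mem_relIdeal φ ψ x hx))⟩

instance : ComAlg k (BraidedTensor B C ⧸ relIdeal φ ψ) where
  toIndObj := quotObj _ (D_mem_relIdeal φ ψ)
  D_mul' := by
    refine TensorProduct.ext' fun x y => ?_
    obtain ⟨x, rfl⟩ := Ideal.Quotient.mk_surjective x
    obtain ⟨y, rfl⟩ := Ideal.Quotient.mk_surjective y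
    exact congrArg (Ideal.Quotient.mk (relIdeal φ ψ)) (D_mul k x y)
  mul_braid := by
    refine TensorProduct.ext' fun x y => ?_
    obtain ⟨x, rfl⟩ := Ideal.Quotient.mk_surjective x
    obtain ⟨y, rfl⟩ := Ideal.Quotient.mk_surjective y
    exact congrArg (Ideal.Quotient.mk (relIdeal φ ψ)) (mul_comm' k x y)

/-- The algebra `B ⊗_A C`. -/
def pushout : AlgC k := ⟨BraidedTensor B C ⧸ relIdeal φ ψ⟩

/-- `b ↦ b ⊗ 1`. -/
def inl : B ⟶ pushout φ ψ where
  toFun b := Ideal.Quotient.mk (relIdeal φ ψ) (tmul b 1)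
  map_one' := rfl
  map_mul' b b' := by
    refine congrArg (Ideal.Quotient.mk (relIdeal φ ψ)) ?_
    change tmul (b * b') 1 = tmul b 1 * tmul b' 1
    rw [tmul_mul_tmul, D_one, zero_mul, tmul_zero, add_zero, one_mul]
  map_zero' := congrArg (Ideal.Quotient.mk (relIdeal φ ψ)) (zero_tmul 1)
  map_add' b b' := congrArg (Ideal.Quotient.mk (relIdeal φ ψ)) (add_tmul b b' 1)
  commutes' r := by
    refine congrArg (Ideal.Quotient.mk (relIdeal φ ψ)) ?_
    rw [Algebra.algebraMap_eq_smul_one, Algebra.algebraMap_eq_smul_one]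
    rfl
  map_D b := by
    change Ideal.Quotient.mk (relIdeal φ ψ) (tmul (D k b) 1) =
      Ideal.Quotient.mk (relIdeal φ ψ) (D k (tmul b 1))
    rw [D_tmul, D_one, tmul_zero, add_zero]

/-- `c ↦ 1 ⊗ c`. -/
def inr : C ⟶ pushout φ ψ where
  toFun c := Ideal.Quotient.mk (relIdeal φ ψ) (tmul 1 c)
  map_one' := rfl
  map_mul' c c' := by
    refine congrArg (Ideal.Quotient.mk (relIdeal φ ψ)) ?_
    change tmul 1 (c * c') = tmul 1 c * tmul 1 c'
    rw [tmul_mul_tmul, D_one, mul_zero, zero_tmul, add_zero, one_mul]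
  map_zero' := congrArg (Ideal.Quotient.mk (relIdeal φ ψ)) (tmul_zero 1)
  map_add' c c' := congrArg (Ideal.Quotient.mk (relIdeal φ ψ)) (tmul_add 1 c c')
  commutes' r := by
    refine congrArg (Ideal.Quotient.mk (relIdeal φ ψ)) ?_
    rw [Algebra.algebraMap_eq_smul_one, Algebra.algebraMap_eq_smul_one]
    exact TensorProduct.tmul_smul r (1 : B) (1 : C)
  map_D c := by
    change Ideal.Quotient.mk (relIdeal φ ψ) (tmul 1 (D k c)) =
      Ideal.Quotient.mk (relIdeal φ ψ) (D k (tmul 1 c))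
    rw [D_tmul, D_one, zero_tmul, zero_add]

theorem comp_inl_eq_comp_inr : φ ≫ inl φ ψ = ψ ≫ inr φ ψ := by
  refine DFunLike.ext _ _ fun a => (Ideal.Quotient.mk_eq_mk_iff_sub_mem _ _).2 ?_
  have h := rel_mem φ ψ 1 a 1
  rw [one_mul, mul_one] at h
  exact h

/-- This converts compatibility, tested on the pushout, into the relation used for descent. -/
theorem inl_eq_inr {b : B} {c : C} (h : inl φ ψ b = inr φ ψ c) :
    b ⊗ₜ[k] (1 : C) - (1 : B) ⊗ₜ[k] c ∈ bcRel φ (restrict ψ (self C)) :=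
  (Ideal.Quotient.mk_eq_mk_iff_sub_mem _ _).1 h

end pushout

end BraidedTensor

/-! ### Faithfully flat descent of elements -/

/-- A submodule stable under `D`. -/
def ModC.sub (M : ModC A) (S : Submodule A M) (h : ∀ x ∈ S, D k x ∈ S) : ModC A :=
  letI o : IndObj k S :=
    { D := ((D k).restrict (p := S.restrictScalars k) (q := S.restrictScalars k) h : S →ₗ[k] S)
      D_D := fun x => Subtype.ext (D_D k (x : M)) }
  { carrier := S
    obj := o
    isMod := ⟨fun a x => Subtype.ext (IsMod.D_smul (k := k) a (x : M))⟩ }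

/-- The inclusion of a submodule. -/
def ModC.subIncl (M : ModC A) (S : Submodule A M) (h : ∀ x ∈ S, D k x ∈ S) :
    ModC.Hom (M.sub S h) M where
  toLinearMap := S.subtype
  map_D _ := rfl

/-- The quotient by a submodule stable under `D`. -/
def ModC.quot (M : ModC A) (S : Submodule A M) (h : ∀ x ∈ S, D k x ∈ S) : ModC A :=
  letI := quotObj S h
  { carrier := M ⧸ S
    isMod := ⟨fun a x => by
      obtain ⟨x, rfl⟩ := Submodule.Quotient.mk_surjective _ x
      exact congrArg (Submodule.Quotient.mk (p := S)) (IsMod.D_smul (k := k) a x)⟩ }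

/-- The projection to a quotient. -/
def ModC.quotMk (M : ModC A) (S : Submodule A M) (h : ∀ x ∈ S, D k x ∈ S) :
    ModC.Hom M (M.quot S h) where
  toLinearMap := S.mkQ
  map_D _ := rfl

theorem bcMap_mk (φ : A ⟶ B) {M N : ModC A} (f : ModC.Hom M N) (b : B) (m : M) :
    bcMap φ f (bcMk φ M b m) = b • bcInl φ N (f.toLinearMap m) := rfl

/-- A module embeds in its base change along a faithfully flat morphism. -/
theorem FaithfullyFlat.eq_zero_of_bcInl {φ : A ⟶ B} (hφ : FaithfullyFlat φ) (M : ModC A) (m : M)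
    (hm : bcInl φ M m = 0) : m = 0 := by
  let S : Submodule A M :=
    { carrier := {m | bcInl φ M m = 0}
      add_mem' := fun {x y} hx hy => by
        change bcInl φ M (x + y) = 0
        rw [map_add, show bcInl φ M x = 0 from hx, show bcInl φ M y = 0 from hy, add_zero]
      zero_mem' := map_zero (bcInl φ M)
      smul_mem' := fun a x hx => by
        change bcInl φ M (a • x) = 0
        rw [ProjPoint.bcInl_smul, show bcInl φ M x = 0 from hx, smul_zero] }
  have hS : ∀ x ∈ S, D k x ∈ S := fun x hx => by
    change bcInl φ M (D k x) = 0
    rw [bcInl_D, show bcInl φ M x = 0 from hx, map_zero]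
  -- For the kernel `S` of `m ↦ 1 ⊗ m`, the map `B ⊗_A S → B ⊗_A M` is zero; by flatness it is also
  -- injective. Hence `B ⊗_A S = 0`, and faithfulness gives `S = 0`.
  have h0 : ∀ y : ModC.baseChange φ (M.sub S hS), bcMap φ (M.subIncl S hS) y = 0 := by
    intro y
    induction y using bc_induction with
    | h b l =>
      have hl : bcInl φ M ((M.subIncl S hS).toLinearMap l) = 0 := l.2
      rw [bcMap_mk, hl, smul_zero]
    | hadd x y hx hy => rw [map_add, hx, hy, add_zero]
  have hinj := hφ.1 _ _ (M.subIncl S hS) S.subtype_injective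
  have hsub := hφ.2 (M.sub S hS) ⟨fun x y => hinj ((h0 x).trans (h0 y).symm)⟩
  have h := hsub.elim (⟨m, hm⟩ : S) (0 : S)
  exact congrArg (fun x : S => (x : M)) h

/-- In the base change of the regular module `1 ⊗ a = φ a ⊗ 1`, so this is the embedding of `A` in
its own base change. -/
theorem FaithfullyFlat.injective {φ : A ⟶ B} (hφ : FaithfullyFlat φ) : Function.Injective φ := by
  refine (injective_iff_map_eq_zero φ).2 fun a ha => hφ.eq_zero_of_bcInl (self A) a ?_
  have h : bcMk φ (self A) 1 (a • (1 : A)) = bcMk φ (self A) (1 * φ a) 1 := bcMk_smul φ _ 1 a 1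
  rw [ha, mul_zero, smul_eq_mul, mul_one] at h
  exact h.trans (congrArg (Submodule.Quotient.mk (p := bcRel φ (self A)))
    (TensorProduct.zero_tmul _ _))

/-- Descent of elements along a faithfully flat morphism. -/
theorem FaithfullyFlat.mem_range {φ : A ⟶ B} (hφ : FaithfullyFlat φ) (b : B)
    (hb : b ⊗ₜ[k] (1 : B) - (1 : B) ⊗ₜ[k] b ∈ bcRel φ (restrict φ (self B))) :
    ∃ a, φ a = b := by
  let M : ModC A := restrict φ (self B)
  let S : Submodule A M :=
    { carrier := Set.range φ
      add_mem' := by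
        rintro _ _ ⟨a, rfl⟩ ⟨b, rfl⟩
        exact ⟨a + b, map_add φ a b⟩
      zero_mem' := ⟨0, map_zero φ⟩
      smul_mem' := by
        rintro c _ ⟨a, rfl⟩
        exact ⟨c * a, map_mul φ c a⟩ }
  have hS : ∀ x ∈ S, D k x ∈ S := by
    rintro _ ⟨a, rfl⟩
    exact ⟨D k a, AlgC.map_D φ a⟩
  -- With `π : B → B / φ(A)`, the map `B ⊗ π` sends `b ⊗ 1` to zero and `1 ⊗ b` to `1 ⊗ π b`. These
  -- agree by hypothesis, and `B / φ(A)` embeds in its base change, so `π b = 0`.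
  let π := M.quotMk S hS
  let e : M := (1 : B)
  let m : M := b
  have h1 : bcMk φ M b e = bcMk φ M 1 m :=
    (Submodule.Quotient.eq (bcRel φ M)).2 hb
  have h2 : π.toLinearMap e = 0 :=
    (Submodule.Quotient.mk_eq_zero S).2 ⟨1, map_one φ⟩
  have h3 := congrArg (bcMap φ π) h1
  rw [bcMap_mk, bcMap_mk, h2, map_zero, smul_zero, one_smul] at h3
  exact (Submodule.Quotient.mk_eq_zero S).1 (hφ.eq_zero_of_bcInl _ _ h3.symm)

/-! ### Descent along finite families -/

section prod
variable {ι : Type} [DecidableEq ι] (E : ι → AlgC k) (φ : ∀ i, A ⟶ E i)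

/-- The inclusion of a factor in the product. -/
def single (i : ι) : E i →ₗ[k] AlgC.prod E := LinearMap.single k (fun i => E i) i

theorem single_mul (i : ι) (x : E i) (y : AlgC.prod E) :
    single E i x * y = single E i (x * (show ∀ i, E i from y) i) :=
  (Pi.single_mul_left (α := fun i => (E i : Type u)) (i := i) (f := y) x).symm

theorem mul_single (i : ι) (x : E i) (y : AlgC.prod E) :
    y * single E i x = single E i ((show ∀ i, E i from y) i * x) :=
  (Pi.single_mul_right (α := fun i => (E i : Type u)) (i := i) (f := y) x).symm

/-- The inclusion of a factor is not unital, but it is multiplicative, and a product with an element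
of one factor sees only that coordinate; so relations go to relations. -/
theorem map_single_mem (i j : ι) (x : E i ⊗[k] restrict (φ j) (self (E j)))
    (hx : x ∈ bcRel (φ i) (restrict (φ j) (self (E j)))) :
    TensorProduct.map (single E i) (single E j) x ∈
      bcRel (AlgC.prodLift E φ) (restrict (AlgC.prodLift E φ) (self (AlgC.prod E))) := by
  have hsmul : ∀ (b : E i) (x : E i ⊗[k] E j),
      TensorProduct.map (single E i) (single E j) (b • x) =
        single E i b • TensorProduct.map (single E i) (single E j) x := by
    intro b x
    induction x with
    | zero => simp
    | add x y hx hy => simp only [smul_add, map_add, hx, hy]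
    | tmul c d =>
      rw [TensorProduct.smul_tmul', TensorProduct.map_tmul, TensorProduct.map_tmul,
        TensorProduct.smul_tmul', smul_eq_mul, smul_eq_mul, single_mul]
      congr 2
      exact congrArg (b * ·) (Pi.single_eq_same (M := fun i => (E i : Type u)) i c).symm
  rw [bcRel] at hx
  induction hx using Submodule.span_induction with
  | zero => exact (congrArg (· ∈ _) (map_zero _)).mpr (zero_mem _)
  | add x y _ _ hx hy => exact (congrArg (· ∈ _) (map_add _ x y)).mpr (add_mem hx hy)
  | smul b x _ hx => exact (congrArg (· ∈ _) (hsmul b x)).mpr (Submodule.smul_mem _ _ hx)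
  | mem x hx =>
    obtain ⟨b, a, c, rfl⟩ := hx
    change E j at c
    refine Submodule.subset_span ⟨single E i b, a, single E j c, ?_⟩
    refine (map_sub _ _ _).trans ?_
    change single E i (b * φ i a) ⊗ₜ[k] single E j c -
      single E i b ⊗ₜ[k] single E j (φ j a * c) =
      (single E i b * AlgC.prodLift E φ a) ⊗ₜ[k] single E j c -
      single E i b ⊗ₜ[k] (AlgC.prodLift E φ a * single E j c)
    rw [single_mul, mul_single]
    rfl

theorem sum_single [Fintype ι] (x : ∀ i, E i) :
    ∑ i, single E i (x i) = (show AlgC.prod E from x) :=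
  Finset.univ_sum_single (M := fun i => (E i : Type u)) x

/-- Descent of elements along a faithfully flat family. -/
theorem FaithfullyFlat.exists_of_family [Finite ι] (h : FaithfullyFlat (AlgC.prodLift E φ))
    (x : ∀ i, E i)
    (hx : ∀ (i j : ι) (C : AlgC k) (f : E i ⟶ C) (g : E j ⟶ C), φ i ≫ f = φ j ≫ g →
      f (x i) = g (x j)) : ∃ a, ∀ i, φ i a = x i := by
  cases nonempty_fintype ι
  obtain ⟨a, ha⟩ := h.mem_range (show AlgC.prod E from x) (by
    have hX := (sum_single E x).symm
    have h1 : (1 : AlgC.prod E) = ∑ i, single E i 1 := (sum_single E fun i => 1).symm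
    -- Both `x` and `1` are split into coordinates; the `(i, j)` term comes from `E i ⊗_A E j`,
    -- where compatibility tested on the pushout applies.
    have key : ((∑ i, single E i (x i)) ⊗ₜ[k] (∑ i, single E i 1) -
        (∑ i, single E i 1) ⊗ₜ[k] (∑ i, single E i (x i))) =
        ∑ i, ∑ j, TensorProduct.map (single E i) (single E j)
          (x i ⊗ₜ[k] (1 : E j) - (1 : E i) ⊗ₜ[k] x j) := by
      simp only [map_sub, TensorProduct.map_tmul, Finset.sum_sub_distrib,
        TensorProduct.sum_tmul, TensorProduct.tmul_sum]
      congr 1 <;> exact Finset.sum_comm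
    rw [hX, h1, key]
    exact Submodule.sum_mem _ fun i _ => Submodule.sum_mem _ fun j _ =>
      map_single_mem E φ i j _ (BraidedTensor.inl_eq_inr _ _
        (hx i j _ _ _ (BraidedTensor.comp_inl_eq_comp_inr (φ i) (φ j)))))
  exact ⟨a, fun i => congrFun ha i⟩

end prod

/-! ### The sheaf condition for `T` and the conclusion -/

/-- The functor of points of `Spec T` is a sheaf. -/
theorem isFaisceau_Phi_T : IsFaisceau (Phi (T k)) := by
  intro ι _ A B φ hφ x hx
  classical
  let x' : ∀ i, T k ⟶ B i := fun i => (x i).down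
  have hinj : ∀ a b : A, (∀ i, φ i a = φ i b) → a = b := fun a b h =>
    hφ.injective (funext h)
  let t : T k := T.of k (TRing.t k)
  obtain ⟨a, ha⟩ := hφ.exists_of_family B φ (fun i => x' i t) (fun i j C f g h => by
    have := congrArg ULift.down (hx i j C f g h)
    exact congrArg (fun ψ : T k ⟶ C => ψ t) this)
  -- The images of `t` glue to an element `a`; the equation that makes it a morphism from `T` can be
  -- checked on the cover.
  have hD : D k a = a ^ 2 := hinj _ _ fun i => by
    rw [AlgC.map_D, map_pow, ha]
    exact T.D_map_t (x' i)
  refine ⟨ULift.up (T.lift a hD), fun i => ?_, fun y hy => ?_⟩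
  · refine ULift.ext _ _ (T.hom_ext ?_)
    change φ i (T.lift a hD t) = x' i t
    rw [T.lift_t, ha]
  · refine ULift.ext _ _ (T.hom_ext ?_)
    let y' : T k ⟶ A := y.down
    change y' t = T.lift a hD t
    rw [T.lift_t]
    refine hinj _ _ fun i => ?_
    rw [ha]
    exact congrArg (fun ψ : T k ⟶ B i => ψ t) (congrArg ULift.down (hy i))

end Ver4

end

theorem proposition7 (k : Type u) [Field k] [CharP k 2]
    (θ : Ver4.ObjIso k (Ver4.P k) (Module.Dual k (Ver4.P k))) :
    (∃ (hT : Ver4.IsFaisceau (Ver4.Phi (Ver4.T k)))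
        (hP : Ver4.IsFaisceau (Ver4.projSpace k (Ver4.P k))),
      IsIso (ObjectProperty.homMk (Ver4.toProj k θ) :
        (⟨Ver4.Phi (Ver4.T k), hT⟩ : Ver4.Fais k) ⟶ ⟨Ver4.projSpace k (Ver4.P k), hP⟩)) ∧
    ∃ r : (Ver4.projSpace k (Ver4.P k)).CorepresentableBy (Ver4.T k),
      r.homEquiv (𝟙 (Ver4.T k)) = Ver4.basePointClass k θ := by
  have hT := Ver4.isFaisceau_Phi_T (k := k)
  have hP := Ver4.isFaisceau_of_iso (asIso (Ver4.toProj k θ)) hT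
  refine ⟨⟨hT, hP, ?_⟩, Ver4.corepresentableBy θ, ?_⟩
  -- Sheaves form a full subcategory, so isomorphisms are detected among functors.
  · have : IsIso ((Ver4.IsFaisceau (k := k)).ι.map (ObjectProperty.homMk (Ver4.toProj k θ) :
        (⟨Ver4.Phi (Ver4.T k), hT⟩ : Ver4.Fais k) ⟶ ⟨Ver4.projSpace k (Ver4.P k), hP⟩)) :=
      Ver4.isIso_toProj θ
    exact isIso_of_fully_faithful (Ver4.IsFaisceau (k := k)).ι _
  · exact ConcreteCategory.congr_hom ((Ver4.projSpace k (Ver4.P k)).map_id (Ver4.T k))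
      (Ver4.basePointClass k θ)
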